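/- Let $p$ be a prime and let $G$ be a pro-$p$ group of exponent $p$, i.e. $g^p=1$ for all $g\in G$. For $n\ge 1$ let $\gamma_n(G)$ be the closure of the $n$-th term of the lower central series of $G$, and let $D_n(G)$ be the closure of the $n$-th dimension subgroup $\{g\in G \mid 1-g\in\omega^n\}$, where $\omega$ is the augmentation ideal of the group ring $\mathbb{F}_p[G]$. Let $\operatorname{gr}^{\mathscr M}_\bullet(G)=\bigoplus_{n\ge1}\gamma_n(G)/\gamma_{n+1}(G)$ (a Lie algebra over $\mathbb{Z}$) and $\operatorname{gr}^{\mathcal Z}_\bullet(G)=\bigoplus_{n\ge1}D_n(G)/D_{n+1}(G)$ (a Lie algebra over $\mathbb{F}_p$), with the brackets induced by the group commutator. (a) There is exactly one $p$-map $(-)^{[p]}$ on the Lie algebra $\operatorname{gr}^{\mathcal Z}_\bullet(G)$ with $(xD_{n+1}(G))^{[p]}=x^pD_{pn+1}(G)$ for all $n\ge1$ and $x\in D_n(G)$. With it, $\operatorname{gr}^{\mathcal Z}_\bullet(G)$ is an $\mathbb{N}$-graded restricted $\mathbb{F}_p$-Lie algebra (that is, $[L_i,L_j]\subseteq L_{i+j}$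 and $L_n^{[p]}\subseteq L_{pn}$ for its homogeneous components $L_n$), and the $p$-map is zero: $x^{[p]}=0$ for every $x\in\operatorname{gr}^{\mathcal Z}_\bullet(G)$. (b) Let $(-)^{[p]}$ also denote the left adjoint of the forgetful functor from restricted $\mathbb{F}_p$-Lie algebras to $\mathbb{F}_p$-Lie algebras, and let $\hat\theta_{G,\bullet}\colon(\operatorname{gr}^{\mathscr M}_\bullet(G)\otimes\mathbb{F}_p)^{[p]}\to\operatorname{gr}^{\mathcal Z}_\bullet(G)$ be the homomorphism of restricted Lie algebras which corresponds under this adjunction to the homomorphism of Lie algebras $\operatorname{gr}^{\mathscr M}_\bullet(G)\otimes\mathbb{F}_p\to\operatorname{gr}^{\mathcal Z}_\bullet(G)$, $x\gamma_{n+1}(G)\otimes1\mapsto xD_{n+1}(G)$. Then $\ker(\hat\theta_{G,\bullet})$ is the restricted ideal of $(\operatorname{gr}^{\mathscr M}_\bullet(G)\otimes\mathbb{F}_p)^{[p]}$ generated by the elements $x^{[p]}$ with $x\in\operatorname{gr}^{\mathscr M}_\bullet(G)\otimes\mathbb{F}_p$, i.e. the smallest Lie ideal that contains these elements and is closed under the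 $p$-map. -/

import Mathlib

noncomputable section

open scoped TensorProduct DirectSum commutatorElement

/-! ### Strongly central series and their associated graded Lie rings -/

/-- A descending strongly central series `G = N₁ ≥ N₂ ≥ ⋯` of a group `G`, that is, one with
`[N_i, N_j] ≤ N_{i+j}`; it is indexed by the positive integers. -/
structure CentralSeries (G : Type*) [Group G] where
  /-- The terms of the series. -/
  N : ℕ+ → Subgroup G
  one_eq_top : N 1 = ⊤
  antitone : Antitone N
  commutator_le : ∀ i j, ⁅N i, N j⁆ ≤ N (i + j)

namespace CentralSeries

variable {G : Type*} [Group G] (F : CentralSeries G)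

theorem comm_mem {i j : ℕ+} {x y : G} (hx : x ∈ F.N i) (hy : y ∈ F.N j) :
    ⁅x, y⁆ ∈ F.N (i + j) :=
  F.commutator_le i j (Subgroup.commutator_mem_commutator hx hy)

theorem mem_one (x : G) : x ∈ F.N 1 := by rw [F.one_eq_top]; trivial

theorem conj_mem {i : ℕ+} {x : G} (g : G) (hx : x ∈ F.N i) : g * x * g⁻¹ ∈ F.N i := by
  have h : g * x * g⁻¹ = ⁅g, x⁆ * x := by simp [commutatorElement_def]
  rw [h]
  exact mul_mem (F.antitone (PNat.lt_add_left i 1).le (F.comm_mem (F.mem_one g) hx)) hx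

instance normal (i : ℕ+) : (F.N i).Normal := ⟨fun _ hx g => F.conj_mem g hx⟩

/-- The `n`-th homogeneous component `N_n / N_{n+1}`. -/
abbrev Comp (n : ℕ+) : Type _ := F.N n ⧸ (F.N (n + 1)).subgroupOf (F.N n)

theorem quot_eq {n : ℕ+} (x y : F.N n) :
    (x : F.Comp n) = y ↔ (x : G)⁻¹ * y ∈ F.N (n + 1) := by
  rw [QuotientGroup.eq, Subgroup.mem_subgroupOf]; simp

instance quotCommGroup (n : ℕ+) : CommGroup (F.Comp n) :=
  { (inferInstance : Group (F.Comp n)) with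
    mul_comm := by
      intro a b
      induction a using QuotientGroup.induction_on with | _ a =>
      induction b using QuotientGroup.induction_on with | _ b =>
      rw [← QuotientGroup.mk_mul, ← QuotientGroup.mk_mul, F.quot_eq]
      have h : ((a * b : F.N n) : G)⁻¹ * ((b * a : F.N n) : G)
          = ⁅(b : G)⁻¹, (a : G)⁻¹⁆ := by
        simp [commutatorElement_def, mul_assoc]
      rw [h]
      have hle : n + 1 ≤ n + n := by
        have h1 : 1 ≤ n := one_le; gcongr
      exact F.antitone hle (F.comm_mem (inv_mem b.2) (inv_mem a.2)) }

/-- The associated graded abelian group `⨁_{n ≥ 1} N_n / N_{n+1}`. -/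
def Gr : Type _ := ⨁ n : ℕ+, Additive (F.Comp n)

instance : AddCommGroup F.Gr := inferInstanceAs (AddCommGroup (⨁ n : ℕ+, Additive (F.Comp n)))

/-- The inclusion of the `n`-th homogeneous component. -/
def of (n : ℕ+) : Additive (F.Comp n) →+ F.Gr :=
  DirectSum.of (fun n => Additive (F.Comp n)) n

/-- The class of `x ∈ N_n` in `N_n / N_{n+1}`, as a homogeneous element of degree `n`. -/
def cls (n : ℕ+) (x : G) (hx : x ∈ F.N n) : F.Gr :=
  F.of n (Additive.ofMul ((⟨x, hx⟩ : F.N n) : F.Comp n))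

variable {F}

theorem cls_congr {n m : ℕ+} {x y : G} (hnm : n = m) (hxy : x = y) (hx : x ∈ F.N n)
    (hy : y ∈ F.N m) : F.cls n x hx = F.cls m y hy := by
  subst hnm; subst hxy; rfl

theorem cls_mul {n : ℕ+} {x y : G} (hx : x ∈ F.N n) (hy : y ∈ F.N n) :
    F.cls n (x * y) (mul_mem hx hy) = F.cls n x hx + F.cls n y hy := by
  rw [cls, cls, cls, ← map_add]; rfl

theorem cls_one (n : ℕ+) : F.cls n 1 (one_mem _) = 0 := by
  rw [cls, ← map_zero (F.of n)]; rfl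

theorem cls_inv {n : ℕ+} {x : G} (hx : x ∈ F.N n) :
    F.cls n x⁻¹ (inv_mem hx) = - F.cls n x hx := by
  rw [cls, cls, ← map_neg]; rfl

theorem cls_pow {n : ℕ+} {x : G} (hx : x ∈ F.N n) (k : ℕ) :
    F.cls n (x ^ k) (pow_mem hx k) = k • F.cls n x hx := by
  rw [cls, cls, ← map_nsmul]; rfl

theorem cls_eq_of_inv_mul_mem {n : ℕ+} {x y : G} (hx : x ∈ F.N n) (hy : y ∈ F.N n)
    (h : x⁻¹ * y ∈ F.N (n + 1)) : F.cls n x hx = F.cls n y hy := by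
  rw [cls, cls]; congr 2; rwa [F.quot_eq]

theorem cls_conj {n : ℕ+} {x : G} (g : G) (hx : x ∈ F.N n) :
    F.cls n (g * x * g⁻¹) (F.conj_mem g hx) = F.cls n x hx := by
  apply cls_eq_of_inv_mul_mem
  have h : (g * x * g⁻¹)⁻¹ * x = ⁅g, x⁻¹⁆ := by simp [commutatorElement_def, mul_assoc]
  rw [h, add_comm]
  exact F.comm_mem (F.mem_one g) (inv_mem hx)

theorem cls_eq_zero {n : ℕ+} {x : G} (hx : x ∈ F.N n) (h : x ∈ F.N (n + 1)) :
    F.cls n x hx = 0 := by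
  rw [← cls_one n]
  exact cls_eq_of_inv_mul_mem _ _ (by simpa using h)

theorem induction {P : F.Gr → Prop} (x : F.Gr) (h0 : P 0)
    (hcls : ∀ n x hx, P (F.cls n x hx)) (hadd : ∀ x y, P x → P y → P (x + y)) : P x := by
  refine DirectSum.induction_on (motive := P) x h0 ?_ hadd
  intro n a
  obtain ⟨⟨g, hg⟩, h⟩ := QuotientGroup.mk_surjective (Additive.toMul a)
  have : a = Additive.ofMul ((⟨g, hg⟩ : F.N n) : F.Comp n) := by rw [h]; rfl
  rw [this]
  exact hcls n g hg

/-- To give an additive map on `F.Gr` it suffices to give multiplicative-to-additive maps on the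
terms of the series, which kill the next term. -/
def liftAdd {A : Type*} [AddCommGroup A] (f : ∀ n : ℕ+, F.N n →* Multiplicative A)
    (hf : ∀ n (x : F.N n), (x : G) ∈ F.N (n + 1) → f n x = 1) : F.Gr →+ A :=
  DirectSum.toAddMonoid (β := fun n => Additive (F.Comp n)) fun n =>
    MonoidHom.toAdditiveLeft (QuotientGroup.lift _ (f n) fun x hx => hf n x hx)

theorem liftAdd_cls {A : Type*} [AddCommGroup A] (f : ∀ n : ℕ+, F.N n →* Multiplicative A)
    (hf : ∀ n (x : F.N n), (x : G) ∈ F.N (n + 1) → f n x = 1) (n : ℕ+) (x : G) (hx : x ∈ F.N n) :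
    liftAdd f hf (F.cls n x hx) = (f n ⟨x, hx⟩).toAdd := by
  rw [liftAdd, cls, of]
  exact (DirectSum.toAddMonoid_of (β := fun n => Additive (F.Comp n)) _ _ _).trans rfl

theorem addHom_ext {A : Type*} [AddCommGroup A] {f g : F.Gr →+ A}
    (h : ∀ n x hx, f (F.cls n x hx) = g (F.cls n x hx)) : f = g := by
  ext x
  induction x using induction with
  | h0 => simp
  | hcls n x hx => exact h n x hx
  | hadd x y hx hy => simp [hx, hy]

theorem cls_comm_mul_left {i j : ℕ+} {x x' y : G} (hx : x ∈ F.N i) (hx' : x' ∈ F.N i)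
    (hy : y ∈ F.N j) :
    F.cls (i + j) ⁅x * x', y⁆ (F.comm_mem (mul_mem hx hx') hy)
      = F.cls (i + j) ⁅x, y⁆ (F.comm_mem hx hy) + F.cls (i + j) ⁅x', y⁆ (F.comm_mem hx' hy) := by
  rw [add_comm (F.cls (i + j) ⁅x, y⁆ _), ← cls_conj x (F.comm_mem hx' hy), ← cls_mul]
  exact cls_congr rfl (by simp [commutatorElement_def, mul_assoc]) _ _

theorem cls_comm_swap {i j : ℕ+} {x y : G} (hx : x ∈ F.N i) (hy : y ∈ F.N j) :
    F.cls (i + j) ⁅x, y⁆ (F.comm_mem hx hy) = - F.cls (j + i) ⁅y, x⁆ (F.comm_mem hy hx) := by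
  rw [← cls_inv]
  exact cls_congr (add_comm _ _) (commutatorElement_inv y x).symm _ _

theorem cls_comm_mul_right {i j : ℕ+} {x y y' : G} (hx : x ∈ F.N i) (hy : y ∈ F.N j)
    (hy' : y' ∈ F.N j) :
    F.cls (i + j) ⁅x, y * y'⁆ (F.comm_mem hx (mul_mem hy hy'))
      = F.cls (i + j) ⁅x, y⁆ (F.comm_mem hx hy) + F.cls (i + j) ⁅x, y'⁆ (F.comm_mem hx hy') := by
  rw [cls_comm_swap hx (mul_mem hy hy'), cls_comm_mul_left hy hy' hx, cls_comm_swap hx hy,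
    cls_comm_swap hx hy', neg_add]

/-- Bracketing with the class of `x ∈ N_i`. -/
def adHom (i : ℕ+) (x : F.N i) : F.Gr →+ F.Gr :=
  liftAdd (fun j =>
    { toFun := fun y => Multiplicative.ofAdd (F.cls (i + j) ⁅(x : G), (y : G)⁆ (F.comm_mem x.2 y.2))
      map_one' := by
        rw [← ofAdd_zero]; congr 1
        rw [← cls_one (i + j)]; exact cls_congr rfl (by simp) _ _
      map_mul' := fun y y' => by
        rw [← ofAdd_add]; congr 1
        exact cls_comm_mul_right x.2 y.2 y'.2 })
    (fun j y hy => by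
      change Multiplicative.ofAdd _ = Multiplicative.ofAdd 0
      congr 1
      exact cls_eq_zero _ (by rw [add_assoc]; exact F.comm_mem x.2 hy))

theorem adHom_cls {i j : ℕ+} {x y : G} (hx : x ∈ F.N i) (hy : y ∈ F.N j) :
    adHom i ⟨x, hx⟩ (F.cls j y hy) = F.cls (i + j) ⁅x, y⁆ (F.comm_mem hx hy) := by
  rw [adHom, liftAdd_cls]; rfl

variable (F) in
/-- The biadditive bracket with `[x N_{i+1}, y N_{j+1}] = [x, y] N_{i+j+1}`. -/
def bracketHom : F.Gr →+ F.Gr →+ F.Gr :=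
  liftAdd (fun i =>
    { toFun := fun x => Multiplicative.ofAdd (adHom i x)
      map_one' := by
        rw [← ofAdd_zero]; congr 1
        refine addHom_ext fun j y hy => ?_
        change adHom (F := F) i ⟨1, one_mem _⟩ _ = 0
        rw [adHom_cls, ← cls_one (i + j)]; exact cls_congr rfl (by simp) _ _
      map_mul' := fun x x' => by
        rw [← ofAdd_add]; congr 1
        refine addHom_ext fun j y hy => ?_
        change adHom (F := F) i ⟨(x : G) * x', mul_mem x.2 x'.2⟩ _
          = adHom (F := F) i ⟨(x : G), x.2⟩ _ + adHom (F := F) i ⟨(x' : G), x'.2⟩ _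
        rw [adHom_cls, adHom_cls, adHom_cls]
        exact cls_comm_mul_left x.2 x'.2 hy })
    (fun i x hx => by
      change Multiplicative.ofAdd _ = Multiplicative.ofAdd 0
      congr 1
      refine addHom_ext fun j y hy => ?_
      change adHom (F := F) i ⟨(x : G), x.2⟩ _ = 0
      rw [adHom_cls]
      exact cls_eq_zero _ (by rw [add_right_comm]; exact F.comm_mem hx hy))

theorem bracketHom_cls {i j : ℕ+} {x y : G} (hx : x ∈ F.N i) (hy : y ∈ F.N j) :
    F.bracketHom (F.cls i x hx) (F.cls j y hy) = F.cls (i + j) ⁅x, y⁆ (F.comm_mem hx hy) := by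
  rw [bracketHom, liftAdd_cls]
  exact adHom_cls hx hy

theorem bracketHom_swap (a b : F.Gr) : F.bracketHom a b = - F.bracketHom b a := by
  induction a using induction with
  | h0 => simp
  | hadd a a' h h' => simp [h, h', add_comm]
  | hcls i x hx =>
    induction b using induction with
    | h0 => simp
    | hadd b b' h h' => simp [h, h', add_comm]
    | hcls j y hy => rw [bracketHom_cls, bracketHom_cls, cls_comm_swap hx hy]

theorem bracketHom_self (a : F.Gr) : F.bracketHom a a = 0 := by
  induction a using induction with
  | h0 => simp
  | hadd a a' h h' => simp [h, h', bracketHom_swap a a']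
  | hcls i x hx =>
    rw [bracketHom_cls, ← cls_one (i + i)]
    exact cls_congr rfl (by simp) _ _

theorem bracketHom_jacobi (a b c : F.Gr) :
    F.bracketHom (F.bracketHom a b) c + F.bracketHom (F.bracketHom b c) a
      + F.bracketHom (F.bracketHom c a) b = 0 := by
  induction a using induction with
  | h0 => simp
  | hadd a a' h h' =>
    rw [← add_zero (0 : F.Gr)]; nth_rw 1 [← h]; rw [← h']
    simp only [map_add, AddMonoidHom.add_apply]; abel
  | hcls i x hx =>
  induction b using induction with
  | h0 => simp
  | hadd a a' h h' =>
    rw [← add_zero (0 : F.Gr)]; nth_rw 1 [← h]; rw [← h']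
    simp only [map_add, AddMonoidHom.add_apply]; abel
  | hcls j y hy =>
  induction c using induction with
  | h0 => simp
  | hadd a a' h h' =>
    rw [← add_zero (0 : F.Gr)]; nth_rw 1 [← h]; rw [← h']
    simp only [map_add, AddMonoidHom.add_apply]; abel
  | hcls k z hz =>
    have e : ∀ {i j k : ℕ+} {x y z : G} (hx : x ∈ F.N i) (hy : y ∈ F.N j) (hz : z ∈ F.N k),
        F.bracketHom (F.bracketHom (F.cls i x hx) (F.cls j y hy)) (F.cls k z hz)
          = F.cls (i + j + k) ⁅⁅x, y⁆, y * z * y⁻¹⁆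
              (F.comm_mem (F.comm_mem hx hy) (F.conj_mem y hz)) := by
      intro i j k x y z hx hy hz
      rw [bracketHom_cls, ← cls_conj y hz, bracketHom_cls]
    have e1 : j + k + i = i + j + k := by rw [add_comm, add_assoc]
    have e2 : k + i + j = i + j + k := by rw [add_assoc, add_comm]
    have m1 : ⁅⁅y, z⁆, z * x * z⁻¹⁆ ∈ F.N (i + j + k) :=
      e1 ▸ F.comm_mem (F.comm_mem hy hz) (F.conj_mem z hx)
    have m2 : ⁅⁅z, x⁆, x * y * x⁻¹⁆ ∈ F.N (i + j + k) :=
      e2 ▸ F.comm_mem (F.comm_mem hz hx) (F.conj_mem x hy)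
    rw [e hx hy hz, e hy hz hx, e hz hx hy, cls_congr e1 rfl _ m1, cls_congr e2 rfl _ m2,
      ← cls_mul _ m1, ← cls_mul _ m2, ← cls_one (i + j + k)]
    exact cls_congr rfl (commutatorElement_commutatorElement_conj_mul x y z) _ _

/-- The associated graded Lie ring. -/
instance : LieRing F.Gr where
  bracket a b := F.bracketHom a b
  add_lie a b c := by simp
  lie_add a b c := by simp
  lie_self a := bracketHom_self a
  leibniz_lie a b c := by
    change F.bracketHom a (F.bracketHom b c) = F.bracketHom (F.bracketHom a b) c
      + F.bracketHom b (F.bracketHom a c)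
    have h := bracketHom_jacobi a b c
    rw [bracketHom_swap a (F.bracketHom b c), bracketHom_swap b (F.bracketHom a c),
      bracketHom_swap a c, map_neg, AddMonoidHom.neg_apply, neg_neg]
    rw [add_right_comm, add_eq_zero_iff_eq_neg] at h
    rw [h]

theorem lie_cls {i j : ℕ+} {x y : G} (hx : x ∈ F.N i) (hy : y ∈ F.N j) :
    ⁅F.cls i x hx, F.cls j y hy⁆ = F.cls (i + j) ⁅x, y⁆ (F.comm_mem hx hy) :=
  bracketHom_cls hx hy

/-- The additive map `x N_{n+1} ↦ x N'_{n+1}` for two series with `N_n ≤ N'_n`. -/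
def mapAdd {F F' : CentralSeries G} (h : ∀ n, F.N n ≤ F'.N n) : F.Gr →+ F'.Gr :=
  liftAdd (fun n =>
    { toFun := fun x => Multiplicative.ofAdd (F'.cls n (x : G) (h n x.2))
      map_one' := congrArg Multiplicative.ofAdd (cls_one n)
      map_mul' := fun x y => congrArg Multiplicative.ofAdd (cls_mul (h n x.2) (h n y.2)) })
    (fun n _ hx => congrArg Multiplicative.ofAdd (cls_eq_zero _ (h (n + 1) hx)))

theorem mapAdd_cls {F F' : CentralSeries G} (h : ∀ n, F.N n ≤ F'.N n) {n : ℕ+} {x : G}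
    (hx : x ∈ F.N n) : mapAdd h (F.cls n x hx) = F'.cls n x (h n hx) := by
  rw [mapAdd, liftAdd_cls]; rfl

/-- The Lie ring homomorphism `x N_{n+1} ↦ x N'_{n+1}` for two series with `N_n ≤ N'_n`. -/
def map {F F' : CentralSeries G} (h : ∀ n, F.N n ≤ F'.N n) : F.Gr →ₗ⁅ℤ⁆ F'.Gr :=
  { (mapAdd h).toIntLinearMap with
    map_lie' := by
      intro a b
      change mapAdd h ⁅a, b⁆ = ⁅mapAdd h a, mapAdd h b⁆
      induction a using induction with
      | h0 => simp
      | hadd a a' ha ha' => simp only [add_lie, map_add, ha, ha']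
      | hcls i x hx =>
      induction b using induction with
      | h0 => simp
      | hadd a a' ha ha' => simp only [lie_add, map_add, ha, ha']
      | hcls j y hy =>
      rw [lie_cls, mapAdd_cls, mapAdd_cls, mapAdd_cls, lie_cls] }

theorem map_cls {F F' : CentralSeries G} (h : ∀ n, F.N n ≤ F'.N n) {n : ℕ+} {x : G}
    (hx : x ∈ F.N n) : map h (F.cls n x hx) = F'.cls n x (h n hx) :=
  mapAdd_cls h hx

variable (F) in
/-- The series of the closures of the terms. -/
def closure [TopologicalSpace G] [IsTopologicalGroup G] : CentralSeries G where
  N n := (F.N n).topologicalClosure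
  one_eq_top := by
    rw [F.one_eq_top, eq_top_iff]; exact Subgroup.le_topologicalClosure _
  antitone i j h := Subgroup.topologicalClosure_mono (F.antitone h)
  commutator_le i j := by
    rw [Subgroup.commutator_le]
    intro x hx y hy
    have hc : Continuous fun q : G × G => ⁅q.1, q.2⁆ := by
      simp only [commutatorElement_def]; fun_prop
    exact map_mem_closure₂ hc hx hy fun a ha b hb => F.comm_mem ha hb

end CentralSeries

/-! ### Restricted Lie algebras -/

section Restricted

variable {p : ℕ} {F : Type*} [Field F] {L : Type*} [LieRing L] [LieAlgebra F L]

variable (F) in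
/-- `s_k(x, y)`: the coefficient of `t ^ (k - 1)` in the formal expression
`ad (t x + y) ^ (p - 1) (x)`. -/
def sTerm (p k : ℕ) (x y : L) : L :=
  ((Polynomial.C (LieAlgebra.ad F L x) * Polynomial.X
    + Polynomial.C (LieAlgebra.ad F L y)) ^ (p - 1)).coeff (k - 1) x

variable (p F L) in
/-- A `p`-map on a Lie algebra over a field `F` (meant for fields of characteristic `p`).
A restricted Lie algebra is a Lie algebra together with a `p`-map. -/
structure PMap where
  /-- The underlying function `x ↦ x^{[p]}`. -/
  toFun : L → L
  map_smul' : ∀ (c : F) (x : L), toFun (c • x) = c ^ p • toFun x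
  map_add' : ∀ x y : L, toFun (x + y)
    = toFun x + toFun y + ∑ k ∈ Finset.Icc 1 (p - 1), (k : F)⁻¹ • sTerm F p k x y
  lie_toFun' : ∀ x y : L, ⁅toFun x, y⁆ = (LieAlgebra.ad F L x ^ p) y

instance : CoeFun (PMap p F L) fun _ => L → L := ⟨PMap.toFun⟩

/-- An ideal of a restricted Lie algebra is restricted if it is closed under the `p`-map. -/
def PMap.IsRestrictedIdeal (q : PMap p F L) (I : LieIdeal F L) : Prop :=
  ∀ x ∈ I, q x ∈ I

/-- The restricted ideal generated by a set, i.e. the smallest restricted ideal containing it. -/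
def PMap.restrictedIdealSpan (q : PMap p F L) (S : Set L) : LieIdeal F L :=
  sInf {I | q.IsRestrictedIdeal I ∧ S ⊆ I}

theorem PMap.isRestrictedIdeal_span (q : PMap p F L) (S : Set L) :
    q.IsRestrictedIdeal (q.restrictedIdealSpan S) := by
  intro x hx
  rw [← SetLike.mem_coe, PMap.restrictedIdealSpan, LieSubmodule.coe_sInf, Set.mem_iInter₂] at hx ⊢
  exact fun I hI => hI.1 x (hx I hI)

theorem PMap.subset_span (q : PMap p F L) (S : Set L) :
    S ⊆ q.restrictedIdealSpan S := by
  intro x hx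
  rw [PMap.restrictedIdealSpan, LieSubmodule.coe_sInf, Set.mem_iInter₂]
  exact fun I hI => hI.2 hx

/-- An `ℕ`-grading (by positive integers) of a restricted Lie algebra: a direct sum decomposition
with `[L_i, L_j] ⊆ L_{i+j}` and `L_n^{[p]} ⊆ L_{pn}`. -/
structure PMap.IsGrading (q : PMap p F L) (A : ℕ+ → Submodule F L) : Prop where
  isInternal : DirectSum.IsInternal A
  lie_mem : ∀ {i j : ℕ+} {x y : L}, x ∈ A i → y ∈ A j → ⁅x, y⁆ ∈ A (i + j)
  pow_mem : ∀ {n m : ℕ+} {x : L}, (m : ℕ) = p * n → x ∈ A n → q x ∈ A m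

end Restricted

/-! ### Restrictification -/

/-- The coefficient of `t ^ j` in `ad (t x + y) ^ m (x)`, written out in terms of addition and
bracket only. -/
def sRec {A : Type*} [Zero A] [Add A] [Bracket A A] (x y : A) : ℕ → ℕ → A
  | 0, 0 => x
  | 0, _ + 1 => 0
  | m + 1, 0 => ⁅y, sRec x y m 0⁆
  | m + 1, j + 1 => ⁅x, sRec x y m j⁆ + ⁅y, sRec x y m (j + 1)⁆

theorem coeff_eq_sRec {F L : Type*} [Field F] [LieRing L] [LieAlgebra F L] (x y : L) (m j : ℕ) :
    ((Polynomial.C (LieAlgebra.ad F L x) * Polynomial.X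
      + Polynomial.C (LieAlgebra.ad F L y)) ^ m).coeff j x = sRec x y m j := by
  induction m generalizing j with
  | zero =>
    cases j with
    | zero => simp [sRec]
    | succ j => simp [sRec, Polynomial.coeff_one]
  | succ m ih =>
    rw [pow_succ', add_mul, mul_assoc, Polynomial.coeff_add, Polynomial.coeff_C_mul,
      Polynomial.coeff_C_mul]
    cases j with
    | zero => simp [sRec, ← ih]
    | succ j => simp [sRec, ← ih, Polynomial.coeff_X_mul]

/-- A finite sum `f 0 + ⋯ + f (n - 1)`, for an addition which need not satisfy any law. -/
def rawSum {A : Type*} [Zero A] [Add A] (f : ℕ → A) : ℕ → A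
  | 0 => 0
  | n + 1 => rawSum f n + f n

theorem rawSum_eq {A : Type*} [AddCommMonoid A] (f : ℕ → A) (n : ℕ) :
    rawSum f n = ∑ i ∈ Finset.range n, f i := by
  induction n with
  | zero => rfl
  | succ n ih => rw [rawSum, ih, Finset.sum_range_succ]

theorem sum_sTerm_eq {F L : Type*} [Field F] [LieRing L] [LieAlgebra F L] (p : ℕ) (x y : L) :
    ∑ k ∈ Finset.Icc 1 (p - 1), (k : F)⁻¹ • sTerm F p k x y
      = rawSum (fun i => ((i + 1 : ℕ) : F)⁻¹ • sRec x y (p - 1) i) (p - 1) := by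
  rw [rawSum_eq, ← Finset.Ico_add_one_right_eq_Icc, Finset.sum_Ico_eq_sum_range]
  refine Finset.sum_congr (by simp) fun i _ => ?_
  rw [sTerm, coeff_eq_sRec, add_comm 1 i, Nat.add_sub_cancel]

namespace Restrictification

variable (p : ℕ) (F L : Type*) [Field F] [LieRing L] [LieAlgebra F L]

/-- Formal expressions in the elements of `L` and the operations of a restricted Lie algebra. -/
inductive Pre : Type _
  | of : L → Pre
  | zero : Pre
  | add : Pre → Pre → Pre
  | smul : F → Pre → Pre
  | lie : Pre → Pre → Pre
  | pow : Pre → Pre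

variable {F L}

instance : Zero (Pre F L) := ⟨.zero⟩
instance : Add (Pre F L) := ⟨.add⟩
instance : SMul F (Pre F L) := ⟨.smul⟩
instance : Bracket (Pre F L) (Pre F L) := ⟨.lie⟩

/-- The relations: the laws of a Lie algebra over `F`, the laws of a `p`-map, the linearity of
`of : L → Pre F L` and its compatibility with the bracket, and closure under the operations. -/
inductive Rel : Pre F L → Pre F L → Prop
  | add_comm (a b : Pre F L) : Rel (a + b) (b + a)
  | add_assoc (a b c : Pre F L) : Rel (a + b + c) (a + (b + c))
  | zero_add (a : Pre F L) : Rel (0 + a) a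
  | smul_add (r : F) (a b : Pre F L) : Rel (r • (a + b)) (r • a + r • b)
  | add_smul (r s : F) (a : Pre F L) : Rel ((r + s) • a) (r • a + s • a)
  | mul_smul (r s : F) (a : Pre F L) : Rel ((r * s) • a) (r • s • a)
  | one_smul (a : Pre F L) : Rel ((1 : F) • a) a
  | zero_smul (a : Pre F L) : Rel ((0 : F) • a) 0
  | add_lie (a b c : Pre F L) : Rel ⁅a + b, c⁆ (⁅a, c⁆ + ⁅b, c⁆)
  | lie_add (a b c : Pre F L) : Rel ⁅a, b + c⁆ (⁅a, b⁆ + ⁅a, c⁆)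
  | lie_smul (r : F) (a b : Pre F L) : Rel ⁅a, r • b⁆ (r • ⁅a, b⁆)
  | lie_self (a : Pre F L) : Rel ⁅a, a⁆ 0
  | leibniz_lie (a b c : Pre F L) : Rel ⁅a, ⁅b, c⁆⁆ (⁅⁅a, b⁆, c⁆ + ⁅b, ⁅a, c⁆⁆)
  | pow_smul (r : F) (a : Pre F L) : Rel (r • a).pow (r ^ p • a.pow)
  | pow_add (a b : Pre F L) : Rel (a + b).pow
      (a.pow + b.pow + rawSum (fun i => ((i + 1 : ℕ) : F)⁻¹ • sRec a b (p - 1) i) (p - 1))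
  | pow_lie (a b : Pre F L) : Rel ⁅a.pow, b⁆ ((fun c => ⁅a, c⁆)^[p] b)
  | of_add (x y : L) : Rel (.of (x + y)) (.of x + .of y)
  | of_smul (r : F) (x : L) : Rel (.of (r • x)) (r • .of x)
  | of_lie (x y : L) : Rel (.of ⁅x, y⁆) ⁅(.of x : Pre F L), (.of y : Pre F L)⁆
  | add_left {a a' : Pre F L} (b : Pre F L) : Rel a a' → Rel (a + b) (a' + b)
  | add_right (a : Pre F L) {b b' : Pre F L} : Rel b b' → Rel (a + b) (a + b')
  | smul_right (r : F) {a a' : Pre F L} : Rel a a' → Rel (r • a) (r • a')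
  | lie_left {a a' : Pre F L} (b : Pre F L) : Rel a a' → Rel ⁅a, b⁆ ⁅a', b⁆
  | lie_right (a : Pre F L) {b b' : Pre F L} : Rel b b' → Rel ⁅a, b⁆ ⁅a, b'⁆
  | pow_congr {a a' : Pre F L} : Rel a a' → Rel a.pow a'.pow

end Restrictification

/-- The restrictification `L^{[p]}` of a Lie algebra `L` over `F`: the restricted Lie algebra
freely generated by the Lie algebra `L`. It is the value at `L` of the left adjoint of the forgetful
functor from restricted Lie algebras to Lie algebras; the universal property is
`Restrictification.lift`, `lift_of`, `lift_pow` and `lift_unique` below. -/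
def Restrictification (p : ℕ) (F L : Type*) [Field F] [LieRing L] [LieAlgebra F L] : Type _ :=
  Quot (Restrictification.Rel (F := F) (L := L) p)

namespace Restrictification

variable {p : ℕ} {F L : Type*} [Field F] [LieRing L] [LieAlgebra F L]

/-- The class of a formal expression. -/
def toQuot (a : Pre F L) : Restrictification p F L := Quot.mk _ a

theorem toQuot_surjective :
    Function.Surjective (toQuot : Pre F L → Restrictification p F L) := Quot.mk_surjective

instance : Zero (Restrictification p F L) := ⟨toQuot 0⟩
instance : Add (Restrictification p F L) :=
  ⟨Quot.map₂ (· + ·) (fun a _ _ h => .add_right a h) (fun _ _ b h => .add_left b h)⟩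
instance : SMul F (Restrictification p F L) :=
  ⟨fun r => Quot.map (r • ·) fun _ _ h => .smul_right r h⟩
instance : Bracket (Restrictification p F L) (Restrictification p F L) :=
  ⟨Quot.map₂ (fun a b => ⁅a, b⁆) (fun a _ _ h => .lie_right a h) (fun _ _ b h => .lie_left b h)⟩

theorem toQuot_zero : (toQuot 0 : Restrictification p F L) = 0 := rfl
theorem toQuot_add (a b : Pre F L) :
    (toQuot (a + b) : Restrictification p F L) = toQuot a + toQuot b := rfl
theorem toQuot_smul (r : F) (a : Pre F L) :
    (toQuot (r • a) : Restrictification p F L) = r • toQuot a := rfl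
theorem toQuot_lie (a b : Pre F L) :
    (toQuot ⁅a, b⁆ : Restrictification p F L)
      = ⁅(toQuot a : Restrictification p F L), (toQuot b : Restrictification p F L)⁆ := rfl

instance : Neg (Restrictification p F L) := ⟨fun a => (-1 : F) • a⟩

instance : AddCommGroup (Restrictification p F L) where
  add_assoc := by rintro ⟨a⟩ ⟨b⟩ ⟨c⟩; exact Quot.sound (.add_assoc a b c)
  zero_add := by rintro ⟨a⟩; exact Quot.sound (.zero_add a)
  add_zero := by
    rintro ⟨a⟩; exact (Quot.sound (.add_comm a 0)).trans (Quot.sound (.zero_add a))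
  add_comm := by rintro ⟨a⟩ ⟨b⟩; exact Quot.sound (.add_comm a b)
  nsmul := nsmulRec
  zsmul := zsmulRec
  neg_add_cancel := by
    rintro ⟨a⟩
    have h1 : (toQuot ((1 : F) • a) : Restrictification p F L) = toQuot a :=
      Quot.sound (.one_smul a)
    have h2 : (toQuot ((-1 + 1 : F) • a) : Restrictification p F L)
        = toQuot ((-1 : F) • a) + toQuot ((1 : F) • a) := Quot.sound (.add_smul _ _ a)
    have h3 : (toQuot ((0 : F) • a) : Restrictification p F L) = 0 := Quot.sound (.zero_smul a)
    rw [h1, neg_add_cancel, h3] at h2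
    exact h2.symm

instance : Module F (Restrictification p F L) where
  one_smul := by rintro ⟨a⟩; exact Quot.sound (.one_smul a)
  mul_smul r s := by rintro ⟨a⟩; exact Quot.sound (.mul_smul r s a)
  smul_add r := by rintro ⟨a⟩ ⟨b⟩; exact Quot.sound (.smul_add r a b)
  add_smul r s := by rintro ⟨a⟩; exact Quot.sound (.add_smul r s a)
  zero_smul := by rintro ⟨a⟩; exact Quot.sound (.zero_smul a)
  smul_zero r := by
    have h1 : (toQuot ((0 : F) • 0) : Restrictification p F L) = 0 := Quot.sound (.zero_smul 0)
    have h2 : (toQuot ((r * 0) • 0) : Restrictification p F L) = r • toQuot ((0 : F) • 0) :=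
      Quot.sound (.mul_smul r 0 0)
    rw [mul_zero, h1] at h2
    exact h2.symm

instance : LieRing (Restrictification p F L) where
  add_lie := by rintro ⟨a⟩ ⟨b⟩ ⟨c⟩; exact Quot.sound (.add_lie a b c)
  lie_add := by rintro ⟨a⟩ ⟨b⟩ ⟨c⟩; exact Quot.sound (.lie_add a b c)
  lie_self := by rintro ⟨a⟩; exact Quot.sound (.lie_self a)
  leibniz_lie := by rintro ⟨a⟩ ⟨b⟩ ⟨c⟩; exact Quot.sound (.leibniz_lie a b c)

instance : LieAlgebra F (Restrictification p F L) where
  lie_smul r := by rintro ⟨a⟩ ⟨b⟩; exact Quot.sound (.lie_smul r a b)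

theorem toQuot_sRec (a b : Pre F L) (m j : ℕ) :
    (toQuot (sRec a b m j) : Restrictification p F L) = sRec (toQuot a) (toQuot b) m j := by
  induction m generalizing j with
  | zero => cases j <;> rfl
  | succ m ih =>
    cases j with
    | zero => rw [sRec, sRec, toQuot_lie, ih]
    | succ j => rw [sRec, sRec, toQuot_add, toQuot_lie, toQuot_lie, ih, ih]

theorem toQuot_rawSum (f : ℕ → Pre F L) (n : ℕ) :
    (toQuot (rawSum f n) : Restrictification p F L) = rawSum (fun i => toQuot (f i)) n := by
  induction n with
  | zero => rfl
  | succ n ih => rw [rawSum, rawSum, toQuot_add, ih]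

/-- The operation `x ↦ x^{[p]}`. -/
def powOp : Restrictification p F L → Restrictification p F L :=
  Quot.map Pre.pow fun _ _ h => .pow_congr h

theorem powOp_add (x y : Restrictification p F L) : powOp (x + y) = powOp x + powOp y
    + ∑ k ∈ Finset.Icc 1 (p - 1), (k : F)⁻¹ • sTerm F p k x y := by
  obtain ⟨a, rfl⟩ := toQuot_surjective x
  obtain ⟨b, rfl⟩ := toQuot_surjective y
  have h : powOp (toQuot a + toQuot b : Restrictification p F L) = toQuot (Pre.pow a + Pre.pow b
      + rawSum (fun i => ((i + 1 : ℕ) : F)⁻¹ • sRec a b (p - 1) i) (p - 1)) :=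
    Quot.sound (.pow_add a b)
  rw [h, sum_sTerm_eq, toQuot_add, toQuot_rawSum]
  simp only [toQuot_smul, toQuot_sRec]
  rfl

theorem toQuot_iterate (a b : Pre F L) (n : ℕ) :
    (toQuot ((fun c => ⁅a, c⁆)^[n] b) : Restrictification p F L)
      = (LieAlgebra.ad F _ (toQuot a) ^ n) (toQuot b) := by
  induction n with
  | zero => rfl
  | succ n ih => rw [Function.iterate_succ_apply', toQuot_lie, ih, pow_succ']; rfl

theorem lie_powOp (x y : Restrictification p F L) :
    ⁅powOp x, y⁆ = (LieAlgebra.ad F _ x ^ p) y := by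
  obtain ⟨a, rfl⟩ := toQuot_surjective x
  obtain ⟨b, rfl⟩ := toQuot_surjective y
  rw [← toQuot_iterate]
  exact Quot.sound (.pow_lie a b)

variable (p F L) in
/-- The `p`-map of the restrictification. -/
def pMap : PMap p F (Restrictification p F L) where
  toFun := powOp
  map_smul' r := by rintro ⟨a⟩; exact Quot.sound (.pow_smul r a)
  map_add' := powOp_add
  lie_toFun' := lie_powOp

variable (p F L) in
/-- The canonical Lie algebra homomorphism `L → L^{[p]}`. -/
def of : L →ₗ⁅F⁆ Restrictification p F L where
  toFun x := toQuot (.of x)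
  map_add' x y := Quot.sound (.of_add x y)
  map_smul' r x := Quot.sound (.of_smul r x)
  map_lie' := Quot.sound (.of_lie _ _)

variable {R : Type*} [LieRing R] [LieAlgebra F R]

/-- Evaluation of formal expressions in a restricted Lie algebra. -/
def eval (q : PMap p F R) (f : L →ₗ⁅F⁆ R) : Pre F L → R
  | .of x => f x
  | .zero => 0
  | .add a b => eval q f a + eval q f b
  | .smul r a => r • eval q f a
  | .lie a b => ⁅eval q f a, eval q f b⁆
  | .pow a => q (eval q f a)

theorem eval_sRec (q : PMap p F R) (f : L →ₗ⁅F⁆ R) (a b : Pre F L) (m j : ℕ) :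
    eval q f (sRec a b m j) = sRec (eval q f a) (eval q f b) m j := by
  induction m generalizing j with
  | zero => cases j <;> rfl
  | succ m ih =>
    cases j with
    | zero => rw [sRec, sRec, ← ih]; rfl
    | succ j => rw [sRec, sRec, ← ih, ← ih]; rfl

theorem eval_rawSum (q : PMap p F R) (f : L →ₗ⁅F⁆ R) (g : ℕ → Pre F L) (n : ℕ) :
    eval q f (rawSum g n) = rawSum (fun i => eval q f (g i)) n := by
  induction n with
  | zero => rfl
  | succ n ih => rw [rawSum, rawSum, ← ih]; rfl

theorem eval_rel (q : PMap p F R) (f : L →ₗ⁅F⁆ R) {a b : Pre F L} (h : Rel p a b) :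
    eval q f a = eval q f b := by
  have hadd : ∀ a b, eval q f (a + b) = eval q f a + eval q f b := fun _ _ => rfl
  have hsmul : ∀ (r : F) a, eval q f (r • a) = r • eval q f a := fun _ _ => rfl
  have hlie : ∀ a b : Pre F L, eval q f ⁅a, b⁆ = ⁅eval q f a, eval q f b⁆ := fun _ _ => rfl
  have hpow : ∀ a : Pre F L, eval q f a.pow = q (eval q f a) := fun _ => rfl
  have hof : ∀ x : L, eval q f (.of x) = f x := fun _ => rfl
  have hzero : eval q f (0 : Pre F L) = 0 := rfl
  induction h with
  | add_comm a b => simp only [hadd]; exact _root_.add_comm _ _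
  | add_assoc a b c => simp only [hadd]; exact _root_.add_assoc _ _ _
  | zero_add a => simp [hadd, hzero]
  | smul_add r a b => simp [hadd, hsmul]
  | add_smul r s a => simp only [hadd, hsmul]; exact _root_.add_smul _ _ _
  | mul_smul r s a => simp only [hsmul]; exact SemigroupAction.mul_smul _ _ _
  | one_smul a => simp [hsmul]
  | zero_smul a => simp [hsmul, hzero]
  | add_lie a b c => simp [hadd, hlie]
  | lie_add a b c => simp [hadd, hlie]
  | lie_smul r a b => simp [hsmul, hlie]
  | lie_self a => simp [hlie, hzero]
  | leibniz_lie a b c => simp only [hadd, hlie]; exact _root_.leibniz_lie _ _ _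
  | pow_smul r a => simp only [hsmul, hpow]; exact q.map_smul' _ _
  | pow_add a b =>
    rw [hpow, hadd, q.map_add', sum_sTerm_eq, hadd, hadd, hpow, hpow, eval_rawSum]
    simp only [hsmul, eval_sRec]
  | pow_lie a b =>
    rw [hlie, hpow, q.lie_toFun']
    have h : ∀ n : ℕ, (LieAlgebra.ad F R (eval q f a) ^ n) (eval q f b)
        = eval q f ((fun c => ⁅a, c⁆)^[n] b) := by
      intro n
      induction n with
      | zero => rfl
      | succ n ih => rw [Function.iterate_succ_apply', hlie, ← ih, pow_succ']; rfl
    exact h p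
  | of_add x y => simp [hof, hadd]
  | of_smul r x => simp [hof, hsmul]
  | of_lie x y => simp [hof, hlie]
  | add_left b _ ih => simp [hadd, ih]
  | add_right a _ ih => simp [hadd, ih]
  | smul_right r _ ih => simp [hsmul, ih]
  | lie_left b _ ih => simp [hlie, ih]
  | lie_right a _ ih => simp [hlie, ih]
  | pow_congr _ ih => rw [hpow, hpow, ih]

/-- The homomorphism of restricted Lie algebras `L^{[p]} → R` which corresponds to the Lie algebra
homomorphism `f : L → R` under the adjunction. -/
def lift (q : PMap p F R) (f : L →ₗ⁅F⁆ R) : Restrictification p F L →ₗ⁅F⁆ R where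
  toFun := Quot.lift (eval q f) fun _ _ h => eval_rel q f h
  map_add' := by rintro ⟨a⟩ ⟨b⟩; rfl
  map_smul' r := by rintro ⟨a⟩; rfl
  map_lie' := by rintro ⟨a⟩ ⟨b⟩; rfl

theorem lift_of (q : PMap p F R) (f : L →ₗ⁅F⁆ R) (x : L) : lift q f (of p F L x) = f x := rfl

theorem lift_pow (q : PMap p F R) (f : L →ₗ⁅F⁆ R) (a : Restrictification p F L) :
    lift q f (pMap p F L a) = q (lift q f a) := by
  obtain ⟨a⟩ := a; rfl

theorem lift_unique (q : PMap p F R) (f : L →ₗ⁅F⁆ R) (g : Restrictification p F L →ₗ⁅F⁆ R)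
    (hof : ∀ x, g (of p F L x) = f x) (hpow : ∀ a, g (pMap p F L a) = q (g a)) :
    g = lift q f := by
  ext a
  obtain ⟨a⟩ := a
  change g (toQuot a) = lift q f (toQuot a)
  induction a with
  | of x => exact hof x
  | zero => exact (map_zero g).trans (map_zero (lift q f)).symm
  | add a b ha hb =>
    change g (toQuot a + toQuot b) = lift q f (toQuot a + toQuot b)
    rw [map_add, map_add, ha, hb]
  | smul r a ha =>
    change g (r • toQuot a) = lift q f (r • toQuot a)
    rw [map_smul, map_smul, ha]
  | lie a b ha hb =>
    change g ⁅(toQuot a : Restrictification p F L), (toQuot b : Restrictification p F L)⁆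
      = lift q f ⁅(toQuot a : Restrictification p F L), (toQuot b : Restrictification p F L)⁆
    rw [LieHom.map_lie, LieHom.map_lie, ha, hb]
  | pow a ha =>
    change g (pMap p F L (toQuot a)) = lift q f (pMap p F L (toQuot a))
    rw [hpow, lift_pow, ha]

end Restrictification

/-! ### The lower central series and the dimension series -/

section Series

theorem commutator_commutator_le_of_rotate {G : Type*} [Group G] {H₁ H₂ H₃ K : Subgroup G}
    [K.Normal] (h1 : ⁅⁅H₂, H₃⁆, H₁⁆ ≤ K) (h2 : ⁅⁅H₃, H₁⁆, H₂⁆ ≤ K) : ⁅⁅H₁, H₂⁆, H₃⁆ ≤ K := by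
  rw [← QuotientGroup.ker_mk' K, ← Subgroup.map_eq_bot_iff] at h1 h2 ⊢
  simp only [Subgroup.map_commutator] at h1 h2 ⊢
  exact Subgroup.commutator_commutator_eq_bot_of_rotate h1 h2

theorem lowerCentralSeries_commutator_le (G : Type*) [Group G] (i j : ℕ) :
    ⁅(⊤ : Subgroup G).lowerCentralSeries i, (⊤ : Subgroup G).lowerCentralSeries j⁆
      ≤ (⊤ : Subgroup G).lowerCentralSeries (i + j + 1) := by
  induction j generalizing i with
  | zero => exact le_rfl
  | succ j ih =>
    rw [Subgroup.commutator_comm, Subgroup.lowerCentralSeries_succ _ j]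
    refine commutator_commutator_le_of_rotate ?_ ?_
    · rw [Subgroup.commutator_comm ⊤, ← Subgroup.lowerCentralSeries_succ]
      have h := ih (i + 1)
      rwa [add_right_comm i 1 j] at h
    · exact Subgroup.commutator_mono (ih i) le_rfl

/-- The lower central series `γ_1(G) = G`, `γ_{n+1}(G) = [γ_n(G), G]`. -/
def lowerSeries (G : Type*) [Group G] : CentralSeries G where
  N n := (⊤ : Subgroup G).lowerCentralSeries n.natPred
  one_eq_top := rfl
  antitone i j h := Subgroup.lowerCentralSeries_antitone _ (PNat.natPred_le_natPred.2 h)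
  commutator_le i j := by
    have h : (i + j).natPred = i.natPred + j.natPred + 1 := by
      have h1 := i.natPred_add_one
      have h2 := j.natPred_add_one
      have h3 := (i + j).natPred_add_one
      rw [PNat.add_coe] at h3
      omega
    rw [h]
    exact lowerCentralSeries_commutator_le G _ _

variable (R : Type*) [CommRing R] (G : Type*) [Group G]

/-- The augmentation ideal of the group ring `R[G]`, i.e. the kernel of the augmentation map
`R[G] → R` which sends every element of `G` to `1`. -/
def augmentationIdeal : Ideal (MonoidAlgebra R G) :=
  RingHom.ker (MonoidAlgebra.lift R R G (1 : G →* R))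

instance : (augmentationIdeal R G).IsTwoSided := by
  unfold augmentationIdeal; infer_instance

variable {R G} in
theorem pow_mem_augmentationIdeal {n : ℕ} {a : MonoidAlgebra R G}
    (ha : a ∈ augmentationIdeal R G ^ n) (k : ℕ) : a ^ k ∈ augmentationIdeal R G ^ (k * n) := by
  induction k with
  | zero => simp [Submodule.pow_zero]
  | succ k ih =>
    rw [pow_succ, Nat.succ_mul, Ideal.IsTwoSided.pow_add]
    exact Ideal.mul_mem_mul ih ha

/-- The `n`-th dimension subgroup `D_n(G, R) = {g ∈ G | 1 - g ∈ ω_R(G) ^ n}`. -/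
def dimensionSubgroup (n : ℕ) : Subgroup G where
  carrier := {g | 1 - MonoidAlgebra.of R G g ∈ augmentationIdeal R G ^ n}
  one_mem' := by
    change 1 - MonoidAlgebra.of R G 1 ∈ augmentationIdeal R G ^ n
    rw [map_one, sub_self]; exact zero_mem _
  mul_mem' := by
    intro a b ha hb
    have h : 1 - MonoidAlgebra.of R G (a * b) = (1 - MonoidAlgebra.of R G a)
        + MonoidAlgebra.of R G a * (1 - MonoidAlgebra.of R G b) := by
      rw [map_mul]; noncomm_ring
    rw [Set.mem_ofPred_eq] at ha hb ⊢
    rw [h]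
    exact add_mem ha (Ideal.mul_mem_left _ _ hb)
  inv_mem' := by
    intro a ha
    have h : 1 - MonoidAlgebra.of R G a⁻¹
        = -(MonoidAlgebra.of R G a⁻¹ * (1 - MonoidAlgebra.of R G a)) := by
      rw [mul_sub, ← map_mul, inv_mul_cancel, map_one]; noncomm_ring
    rw [Set.mem_ofPred_eq] at ha ⊢
    rw [h]
    exact neg_mem (Ideal.mul_mem_left _ _ ha)

theorem mem_dimensionSubgroup {n : ℕ} {g : G} : g ∈ dimensionSubgroup R G n ↔
    1 - MonoidAlgebra.of R G g ∈ augmentationIdeal R G ^ n := Iff.rfl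

/-- The dimension series of `G` over `R`. -/
def dimensionSeries : CentralSeries G where
  N n := dimensionSubgroup R G n
  one_eq_top := by
    rw [eq_top_iff]
    intro g _
    rw [mem_dimensionSubgroup, PNat.one_coe, Submodule.pow_one, augmentationIdeal, RingHom.mem_ker]
    simp
  antitone i j h := fun g hg => Ideal.pow_le_pow_right h hg
  commutator_le i j := by
    rw [Subgroup.commutator_le]
    intro a ha b hb
    rw [mem_dimensionSubgroup] at ha hb ⊢
    have h : 1 - MonoidAlgebra.of R G ⁅a, b⁆
        = ((1 - MonoidAlgebra.of R G b) * (1 - MonoidAlgebra.of R G a)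
          - (1 - MonoidAlgebra.of R G a) * (1 - MonoidAlgebra.of R G b))
          * MonoidAlgebra.of R G (a⁻¹ * b⁻¹) := by
      have e : (1 - MonoidAlgebra.of R G b) * (1 - MonoidAlgebra.of R G a)
          - (1 - MonoidAlgebra.of R G a) * (1 - MonoidAlgebra.of R G b)
          = MonoidAlgebra.of R G (b * a) - MonoidAlgebra.of R G (a * b) := by
        rw [map_mul, map_mul]; noncomm_ring
      rw [e, sub_mul, ← map_mul, ← map_mul, ← map_one (MonoidAlgebra.of R G)]
      congr 2
      · group
      · simp [commutatorElement_def, mul_assoc]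
    rw [h]
    refine Ideal.mul_mem_right _ _ (sub_mem ?_ ?_)
    · rw [add_comm, PNat.add_coe, Ideal.IsTwoSided.pow_add]
      exact Ideal.mul_mem_mul hb ha
    · rw [PNat.add_coe, Ideal.IsTwoSided.pow_add]
      exact Ideal.mul_mem_mul ha hb

theorem lowerSeries_le_dimensionSeries (n : ℕ+) :
    (lowerSeries G).N n ≤ (dimensionSeries R G).N n := by
  induction n using PNat.recOn with
  | one => rw [(dimensionSeries R G).one_eq_top]; exact le_top
  | succ n ih =>
    have h : (n + 1).natPred = n.natPred + 1 := by
      have h1 := n.natPred_add_one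
      have h3 := (n + 1).natPred_add_one
      rw [PNat.add_coe, PNat.one_coe] at h3
      omega
    change (⊤ : Subgroup G).lowerCentralSeries (n + 1).natPred ≤ _
    rw [h, Subgroup.lowerCentralSeries_succ]
    refine (Subgroup.commutator_mono ih ?_).trans ((dimensionSeries R G).commutator_le n 1)
    rw [(dimensionSeries R G).one_eq_top]

end Series

/-! ### The Magnus and Zassenhaus Lie algebras of a topological group -/

section LieAlgebras

variable (p : ℕ) (G : Type*) [Group G] [TopologicalSpace G] [IsTopologicalGroup G]

/-- The closed lower central series. -/
def magnusSeries : CentralSeries G := (lowerSeries G).closure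

/-- The closed `p`-Zassenhaus series: the closures of the dimension subgroups over `𝔽_p`. -/
def zassenhausSeries : CentralSeries G := (dimensionSeries (ZMod p) G).closure

/-- The Magnus Lie algebra `gr^M(G)` over `ℤ`. -/
abbrev MagnusLie : Type _ := (magnusSeries G).Gr

/-- The Zassenhaus Lie algebra `gr^Z(G)`. -/
abbrev ZassenhausLie : Type _ := (zassenhausSeries p G).Gr

theorem magnusSeries_le (n : ℕ+) : (magnusSeries G).N n ≤ (zassenhausSeries p G).N n :=
  Subgroup.topologicalClosure_mono (lowerSeries_le_dimensionSeries (ZMod p) G n)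

variable [hp : Fact p.Prime]

/-- The prime `p` as a positive integer. -/
def pPos : ℕ+ := ⟨p, hp.out.pos⟩

variable {G} in
theorem pow_mem_zassenhaus {n : ℕ+} {x : G} (hx : x ∈ (zassenhausSeries p G).N n) :
    x ^ p ∈ (zassenhausSeries p G).N (pPos p * n) := by
  have : CharP (MonoidAlgebra (ZMod p) G) p :=
    charP_of_injective_algebraMap (algebraMap (ZMod p) _).injective p
  have hc : Continuous fun a : G => a ^ p := continuous_pow p
  refine map_mem_closure (f := fun a : G => a ^ p) hc hx fun a ha => ?_
  have ha' : 1 - MonoidAlgebra.of (ZMod p) G a ∈ augmentationIdeal (ZMod p) G ^ (n : ℕ) := ha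
  change 1 - MonoidAlgebra.of (ZMod p) G (a ^ p) ∈ augmentationIdeal (ZMod p) G ^ (p * (n : ℕ))
  have h := sub_pow_char_of_commute (p := p) (Commute.one_left (MonoidAlgebra.of (ZMod p) G a))
  rw [map_pow, ← one_pow (M := MonoidAlgebra (ZMod p) G) p, ← h]
  exact pow_mem_augmentationIdeal ha' p

theorem zassenhaus_nsmul (x : ZassenhausLie p G) : p • x = 0 := by
  induction x using CentralSeries.induction with
  | h0 => simp
  | hadd x y hx hy => rw [smul_add, hx, hy, add_zero]
  | hcls n x hx =>
    rw [← CentralSeries.cls_pow]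
    refine CentralSeries.cls_eq_zero _ ((zassenhausSeries p G).antitone ?_ (pow_mem_zassenhaus p hx))
    rw [← PNat.coe_le_coe]
    change (n : ℕ) + 1 ≤ p * n
    have := hp.out.two_le
    have := n.pos
    nlinarith

instance : Module (ZMod p) (ZassenhausLie p G) := AddCommGroup.zmodModule (zassenhaus_nsmul p G)

instance : LieAlgebra (ZMod p) (ZassenhausLie p G) where
  lie_smul c x y :=
    ZMod.map_smul ((zassenhausSeries p G).bracketHom x) c y

/-- The `n`-th homogeneous component `D_n(G) / D_{n+1}(G)` of the Zassenhaus Lie algebra. -/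
def zassenhausComponent (n : ℕ+) : Submodule (ZMod p) (ZassenhausLie p G) :=
  AddSubgroup.toZModSubmodule p ((zassenhausSeries p G).of n).range

variable {p G} in
/-- The `p`-map on the Zassenhaus Lie algebra induced by the `p`-power map of the group:
`(x D_{n+1}(G))^{[p]} = x ^ p D_{pn+1}(G)` for `x ∈ D_n(G)`. -/
def IsInducedByPower (q : PMap p (ZMod p) (ZassenhausLie p G)) : Prop :=
  ∀ (n : ℕ+) (x : G) (hx : x ∈ (zassenhausSeries p G).N n),
    q ((zassenhausSeries p G).cls n x hx)
      = (zassenhausSeries p G).cls (pPos p * n) (x ^ p) (pow_mem_zassenhaus p hx)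

/-- The Lie algebra `gr^M(G) ⊗ 𝔽_p` over `𝔽_p`. -/
abbrev MagnusLieModP : Type _ := ZMod p ⊗[ℤ] MagnusLie G

/-- The Lie ring homomorphism `ρ : gr^M(G) → gr^Z(G)`, `x γ_{n+1}(G) ↦ x D_{n+1}(G)`. -/
def rho : MagnusLie G →ₗ⁅ℤ⁆ ZassenhausLie p G := CentralSeries.map (magnusSeries_le p G)

/-- The linear map underlying `θ`. -/
def thetaLinear : MagnusLieModP p G →ₗ[ZMod p] ZassenhausLie p G :=
  LinearMap.liftBaseChange (ZMod p) (rho p G : MagnusLie G →ₗ[ℤ] ZassenhausLie p G)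

theorem thetaLinear_tmul (r : ZMod p) (x : MagnusLie G) :
    thetaLinear p G (r ⊗ₜ x) = r • rho p G x :=
  LinearMap.liftBaseChange_tmul ..

/-- The homomorphism `θ : gr^M(G) ⊗ 𝔽_p → gr^Z(G)` of Lie algebras over `𝔽_p` induced by `ρ`. -/
def theta : MagnusLieModP p G →ₗ⁅ZMod p⁆ ZassenhausLie p G :=
  { thetaLinear p G with
    map_lie' := by
      intro a b
      refine (?_ : thetaLinear p G _ = ⁅thetaLinear p G a, thetaLinear p G b⁆)
      induction a using TensorProduct.induction_on with
      | zero => rw [zero_lie, map_zero, zero_lie]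
      | add a a' ha ha' => rw [add_lie, map_add, map_add, ha, ha', add_lie]
      | tmul r x =>
      induction b using TensorProduct.induction_on with
      | zero => rw [lie_zero, map_zero, lie_zero]
      | add b b' hb hb' => rw [lie_add, map_add, map_add, hb, hb', lie_add]
      | tmul s y =>
        refine (thetaLinear_tmul p G (r * s) ⁅x, y⁆).trans ?_
        rw [thetaLinear_tmul, thetaLinear_tmul, LieHom.map_lie, smul_lie, lie_smul, mul_smul] }

theorem theta_tmul (r : ZMod p) (x : MagnusLie G) : theta p G (r ⊗ₜ x) = r • rho p G x :=
  thetaLinear_tmul p G r x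

variable {p G} in
/-- The homomorphism of restricted Lie algebras
`θ̂ : (gr^M(G) ⊗ 𝔽_p)^{[p]} → gr^Z(G)` induced by `θ`. Its kernel is the Magnus–Zassenhaus
kernel. -/
def thetaHat (q : PMap p (ZMod p) (ZassenhausLie p G)) :
    Restrictification p (ZMod p) (MagnusLieModP p G) →ₗ⁅ZMod p⁆ ZassenhausLie p G :=
  Restrictification.lift q (theta p G)

/-- Pro-`p` groups: profinite groups all of whose quotients by open normal subgroups are
`p`-groups. -/
structure IsProP (p : ℕ) (G : Type*) [Group G] [TopologicalSpace G] [IsTopologicalGroup G] :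
    Prop where
  compactSpace : CompactSpace G
  t2Space : T2Space G
  totallyDisconnectedSpace : TotallyDisconnectedSpace G
  isPGroup_quotient : ∀ U : OpenNormalSubgroup G, IsPGroup p (G ⧸ U.toSubgroup)

end LieAlgebras

end

/-!
In exponent `p` two facts carry the theorem.

*The two series agree.* Jennings' theorem for exponent `p` says that a finite group has the same
dimension subgroups over `𝔽_p` and lower central series. Let `F` be a central series and filter
`𝔽_p[K]`, for a subgroup `K`, by the products of the `k - 1` with `k ∈ K`, weighted by `F`
(`HasWeight`). If `K` is generated by a normal subgroup `M` of index `p` and an element `x` of lowest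
weight `w`, then straightening with `k x = x k [k⁻¹, x⁻¹]` shows that elements of weight `n` expand
as `∑_{j < p} (x - 1) ^ j b_j` with `b_j ∈ 𝔽_p[M]` of weight `n - j w` (`HornerWeight`). These
expansions are unique, and comparing the two lowest coefficients of `x ^ i k - 1` gives an induction
on the order of `K` (`mem_of_hasWeight_sub_one`). Passing to finite quotients of a pro-`p` group,
the closed Zassenhaus series is the closed lower central series (`zassenhausSeries_le`), and hence
`θ` is injective (`theta_injective`).

*The Engel condition.* The Zassenhaus Lie algebra satisfies `ad (z) ^ (p - 1) = 0`
(`ad_pow_pred_eq_zero`). By multilinearity it is enough to treat the sum, over all orderings, of the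
iterated commutators of homogeneous elements, represented by `z_1, …, z_{p-1}` and `x` in `G`. For
a set `S` of indices let `h` be the product of the `z_i` with `i ∈ S`. The relation `(x h) ^ p = 1`
says that the product of the `p` conjugates `h ^ k x h ^ {-k}` is `1`, so that their logarithmic
leading term `∑_k h ^ k (x - 1) h ^ {-k} = (conj h - 1) ^ (p - 1) (x - 1)` is a sum of products that
involve `x - 1` at least twice. Taking the alternating sum over all `S` isolates the terms that
involve every `z_i`; modulo higher order the right-hand side becomes the symmetrized commutator, by
polarization. The bookkeeping of orders is done by `IsMoebius`.

Given the Engel condition, every correction term `s_k(x, y)` in the axioms of a `p`-map vanishes, as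
they are the coefficients of the polynomial `ad (t x + y) ^ (p - 1) (x)` of degree less than `p`,
which is zero at all `t ∈ 𝔽_p`. So zero is a `p`-map, and a `p`-map induced by the power map of `G` is
additive and kills homogeneous elements, hence is zero. For the kernel of `θ̂`: modulo the restricted
ideal generated by the `x^{[p]}` every element of the restrictification comes from
`gr^M(G) ⊗ 𝔽_p`, where `θ` is injective.
-/

noncomputable section

open scoped TensorProduct DirectSum commutatorElement

/-! ### Powers in characteristic `p` -/

/-- In characteristic `p` the `(p - 1)`-st power of `x - 1` is the geometric sum, because
`(x - 1) ^ p = x ^ p - 1`. -/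
theorem sub_one_pow_pred_eq_geom_sum (p : ℕ) [Fact p.Prime] {A : Type*} [Ring A]
    [Algebra (ZMod p) A] (x : A) : (x - 1) ^ (p - 1) = ∑ j ∈ Finset.range p, x ^ j := by
  have h : (Polynomial.X - 1 : Polynomial (ZMod p)) ^ (p - 1)
      = ∑ j ∈ Finset.range p, Polynomial.X ^ j := by
    have hne : (Polynomial.X - 1 : Polynomial (ZMod p)) ≠ 0 := Polynomial.X_sub_C_ne_zero 1
    refine mul_right_cancel₀ hne ?_
    rw [geom_sum_mul, ← pow_succ, Nat.sub_add_cancel (Fact.out : p.Prime).one_le, sub_pow_char,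
      one_pow]
  simpa using congrArg (Polynomial.aeval x) h

/-! ### The filtration of a group algebra by a central series -/

section Jennings

variable {p : ℕ} {G : Type*} [Group G] {F : CentralSeries G}

/-- `HasWeight p F K n a` says that `a ∈ 𝔽_p[G]` lies in the span of the products
`(k₁ - 1) ⋯ (k_r - 1)` with `k_i ∈ K ∩ N_{m_i}` and `m₁ + ⋯ + m_r ≥ n`. -/
inductive HasWeight (p : ℕ) (F : CentralSeries G) (K : Subgroup G) :
    ℕ → MonoidAlgebra (ZMod p) G → Prop
  | one : HasWeight p F K 0 1
  | sub_one_mul {k : G} {m : ℕ+} {n : ℕ} {a : MonoidAlgebra (ZMod p) G} : k ∈ K → k ∈ F.N m →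
      HasWeight p F K n a → HasWeight p F K (n + m) ((MonoidAlgebra.of (ZMod p) G k - 1) * a)
  | of_succ {n : ℕ} {a : MonoidAlgebra (ZMod p) G} :
      HasWeight p F K (n + 1) a → HasWeight p F K n a
  | zero (n : ℕ) : HasWeight p F K n 0
  | add {n : ℕ} {a b : MonoidAlgebra (ZMod p) G} :
      HasWeight p F K n a → HasWeight p F K n b → HasWeight p F K n (a + b)
  | smul {n : ℕ} {a : MonoidAlgebra (ZMod p) G} (r : ZMod p) :
      HasWeight p F K n a → HasWeight p F K n (r • a)

namespace HasWeight

variable {K : Subgroup G} {n : ℕ} {a : MonoidAlgebra (ZMod p) G}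

theorem mono {m : ℕ} (h : HasWeight p F K n a) (hmn : m ≤ n) : HasWeight p F K m a := by
  induction hmn with
  | refl => exact h
  | step _ ih => exact ih h.of_succ

theorem of_mul {k : G} (hk : k ∈ K) (h : HasWeight p F K n a) :
    HasWeight p F K n (MonoidAlgebra.of (ZMod p) G k * a) := by
  have h1 := ((h.sub_one_mul hk (F.mem_one k)).mono (Nat.le_add_right _ _)).add h
  rwa [sub_mul, one_mul, sub_add_cancel] at h1

/-- Elements of positive weight have augmentation zero. -/
theorem augmentation_eq_zero (h : HasWeight p F K n a) (hn : n ≠ 0) :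
    MonoidAlgebra.lift (ZMod p) (ZMod p) G 1 a = 0 := by
  induction h with
  | one => exact absurd rfl hn
  | sub_one_mul => simp
  | of_succ _ ih => exact ih (Nat.succ_ne_zero _)
  | zero => simp
  | add _ _ ih ih' => rw [map_add, ih hn, ih' hn, add_zero]
  | smul r _ ih => rw [map_smul, ih hn, smul_zero]

/-- The elements of the filtration defined by `K` are supported on `K`. -/
theorem coeff_eq_zero (h : HasWeight p F K n a) {g : G} (hg : g ∉ K) : a.coeff g = 0 := by
  induction h generalizing g with
  | one =>
    rw [MonoidAlgebra.one_def]
    classical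
    rw [MonoidAlgebra.coeff_single, Finsupp.single_apply, if_neg]
    rintro rfl
    exact hg (one_mem K)
  | @sub_one_mul k m n a hk _ _ ih =>
    have h1 : k⁻¹ * g ∉ K := fun h => hg (by simpa using mul_mem hk h)
    rw [sub_mul, one_mul, MonoidAlgebra.coeff_sub, Finsupp.sub_apply, MonoidAlgebra.of_apply,
      MonoidAlgebra.coeff_single_mul_apply, ih hg, ih h1]
    simp
  | of_succ _ ih => exact ih hg
  | zero => simp
  | add _ _ ih ih' => simp [ih hg, ih' hg]
  | smul r _ ih => simp [ih hg]

end HasWeight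

/-- The augmentation ideal powers are contained in the filtration defined by any central series. -/
theorem hasWeight_of_mem_augmentationIdeal_pow (F : CentralSeries G) {n : ℕ}
    {a : MonoidAlgebra (ZMod p) G} (ha : a ∈ augmentationIdeal (ZMod p) G ^ n) :
    HasWeight p F ⊤ n a := by
  have hleft : ∀ (x : MonoidAlgebra (ZMod p) G) {n : ℕ} {b : MonoidAlgebra (ZMod p) G},
      HasWeight p F ⊤ n b → HasWeight p F ⊤ n (x * b) := by
    intro x n b hb
    induction x using MonoidAlgebra.induction_on with
    | of g => exact hb.of_mul (Subgroup.mem_top g)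
    | add x y hx hy => rw [add_mul]; exact hx.add hy
    | smul r x hx => rw [smul_mul_assoc]; exact hx.smul r
  have haug : ∀ (x : MonoidAlgebra (ZMod p) G) {n : ℕ} {b : MonoidAlgebra (ZMod p) G},
      HasWeight p F ⊤ n b → HasWeight p F ⊤ (n + 1)
        ((x - algebraMap (ZMod p) _ (MonoidAlgebra.lift (ZMod p) (ZMod p) G 1 x)) * b) := by
    intro x n b hb
    induction x using MonoidAlgebra.induction_on with
    | of g =>
      have h := hb.sub_one_mul (Subgroup.mem_top g) (F.mem_one g)
      rwa [MonoidAlgebra.lift_of, MonoidHom.one_apply, map_one]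
    | add x y hx hy =>
      rw [map_add, map_add, add_sub_add_comm, add_mul]
      exact hx.add hy
    | smul r x hx =>
      rw [map_smul, smul_eq_mul, map_mul, ← Algebra.smul_def, ← smul_sub, smul_mul_assoc]
      exact hx.smul r
  induction n generalizing a with
  | zero => simpa using hleft a HasWeight.one
  | succ n ih =>
    rw [add_comm, Ideal.IsTwoSided.pow_add, Submodule.pow_one] at ha
    refine Submodule.mul_induction_on ha (fun x hx y hy => ?_) fun x y hx hy => hx.add hy
    have h := haug x (ih hy)
    have hx' : MonoidAlgebra.lift (ZMod p) (ZMod p) G 1 x = 0 := hx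
    rwa [hx', map_zero, sub_zero] at h

/-- `HornerWeight p F K x w e n a` says that `a = ∑_{j < e} (x - 1) ^ j b_j`, where `b_j` has
weight at least `n - j w` (read as `0` if negative) in the filtration defined by `K`. The expansion
is written in Horner form. -/
def HornerWeight (p : ℕ) (F : CentralSeries G) (K : Subgroup G) (x : G) (w : ℕ) :
    ℕ → ℕ → MonoidAlgebra (ZMod p) G → Prop
  | 0, _, a => a = 0
  | e + 1, n, a => ∃ b a', HasWeight p F K n b ∧ HornerWeight p F K x w e (n - w) a' ∧
      a = b + (MonoidAlgebra.of (ZMod p) G x - 1) * a'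

namespace HornerWeight

variable {K : Subgroup G} {x : G} {w e n : ℕ} {a b : MonoidAlgebra (ZMod p) G}

theorem zero (e n : ℕ) : HornerWeight p F K x w e n 0 := by
  induction e generalizing n with
  | zero => rfl
  | succ e ih => exact ⟨0, 0, .zero n, ih _, by simp⟩

theorem add (ha : HornerWeight p F K x w e n a) (hb : HornerWeight p F K x w e n b) :
    HornerWeight p F K x w e n (a + b) := by
  induction e generalizing n a b with
  | zero => rw [HornerWeight] at *; rw [ha, hb, add_zero]
  | succ e ih =>
    obtain ⟨c, a', hc, ha', rfl⟩ := ha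
    obtain ⟨d, b', hd, hb', rfl⟩ := hb
    exact ⟨c + d, a' + b', hc.add hd, ih ha' hb', by noncomm_ring⟩

theorem smul (r : ZMod p) (ha : HornerWeight p F K x w e n a) :
    HornerWeight p F K x w e n (r • a) := by
  induction e generalizing n a with
  | zero => rw [HornerWeight] at *; rw [ha, smul_zero]
  | succ e ih =>
    obtain ⟨c, a', hc, ha', rfl⟩ := ha
    exact ⟨r • c, r • a', hc.smul r, ih ha', by rw [smul_add, mul_smul_comm]⟩

theorem mono {m : ℕ} (ha : HornerWeight p F K x w e n a) (h : m ≤ n) :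
    HornerWeight p F K x w e m a := by
  induction e generalizing n m a with
  | zero => exact ha
  | succ e ih =>
    obtain ⟨c, a', hc, ha', rfl⟩ := ha
    exact ⟨c, a', hc.mono h, ih ha' (Nat.sub_le_sub_right h w), rfl⟩

theorem of_hasWeight (ha : HasWeight p F K n a) : HornerWeight p F K x w (e + 1) n a :=
  ⟨a, 0, ha, zero _ _, by simp⟩

theorem succ (ha : HornerWeight p F K x w e n a) : HornerWeight p F K x w (e + 1) n a := by
  induction e generalizing n a with
  | zero => rw [HornerWeight] at ha; rw [ha]; exact zero _ _
  | succ e ih =>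
    obtain ⟨c, a', hc, ha', rfl⟩ := ha
    exact ⟨c, a', hc, ih ha', rfl⟩

theorem sub_one_mul_succ (ha : HornerWeight p F K x w e n a) :
    HornerWeight p F K x w (e + 1) (n + w) ((MonoidAlgebra.of (ZMod p) G x - 1) * a) :=
  ⟨0, a, .zero _, by rwa [Nat.add_sub_cancel], by simp⟩

/-- The last term of an expansion, split off. -/
theorem exists_eq_add_pow_mul (ha : HornerWeight p F K x w (e + 1) n a) :
    ∃ a' b, HornerWeight p F K x w e n a' ∧
      a = a' + (MonoidAlgebra.of (ZMod p) G x - 1) ^ e * b := by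
  induction e generalizing n a with
  | zero =>
    obtain ⟨b, a', -, h, rfl⟩ := ha
    rw [HornerWeight] at h
    exact ⟨0, b, rfl, by simp [h]⟩
  | succ e ih =>
    obtain ⟨b, a', hb, h, rfl⟩ := ha
    obtain ⟨a'', c, h', rfl⟩ := ih h
    exact ⟨_, c, ⟨b, a'', hb, h', rfl⟩, by rw [pow_succ']; noncomm_ring⟩

/-- If `x ^ p = 1` then `(x - 1) ^ p = 0`, so that expansions of length `p` suffice. -/
theorem sub_one_mul [Fact p.Prime] (hx : x ^ p = 1) (ha : HornerWeight p F K x w p n a) :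
    HornerWeight p F K x w p (n + w) ((MonoidAlgebra.of (ZMod p) G x - 1) * a) := by
  obtain ⟨a', b, h, h'⟩ := ha.sub_one_mul_succ.exists_eq_add_pow_mul
  have : CharP (MonoidAlgebra (ZMod p) G) p :=
    charP_of_injective_algebraMap (algebraMap (ZMod p) _).injective p
  have hpow : (MonoidAlgebra.of (ZMod p) G x - 1) ^ p = 0 := by
    rw [sub_pow_char_of_commute (p := p) (Commute.one_right _), ← map_pow, hx, map_one, one_pow,
      sub_self]
  rwa [h', hpow, zero_mul, add_zero]

/-- Straightening: multiplication by `k - 1` with `k ∈ K ∩ N_m` is moved past the powers of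
`x - 1` by means of `k x = x k c`, where `c = [k⁻¹, x⁻¹] ∈ K ∩ N_{m + w}`. -/
theorem sub_one_mul_of_mem {w : ℕ+} (hx : x ∈ F.N w) (hK : ∀ k ∈ K, ⁅k⁻¹, x⁻¹⁆ ∈ K)
    {k : G} {m : ℕ+} (hk : k ∈ K) (hkm : k ∈ F.N m) (ha : HornerWeight p F K x w e n a) :
    HornerWeight p F K x w e (n + m) ((MonoidAlgebra.of (ZMod p) G k - 1) * a) := by
  induction e generalizing k m n a with
  | zero => rw [HornerWeight] at *; rw [ha, mul_zero]
  | succ e ih =>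
    obtain ⟨b, a', hb, h, rfl⟩ := ha
    set c : G := ⁅k⁻¹, x⁻¹⁆ with hc
    have hcK : c ∈ K := hK k hk
    have hcm : c ∈ F.N (m + w) := F.comm_mem (inv_mem hkm) (inv_mem hx)
    have hkx : MonoidAlgebra.of (ZMod p) G k * MonoidAlgebra.of (ZMod p) G x
        = MonoidAlgebra.of (ZMod p) G x * MonoidAlgebra.of (ZMod p) G k
          * MonoidAlgebra.of (ZMod p) G c := by
      rw [← map_mul, ← map_mul, ← map_mul]
      congr 1
      simp [hc, commutatorElement_def, mul_assoc]
    have h1 := ih hk hkm h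
    have h2 := ih hcK hcm h
    have h3 := (h2.add ((ih hk hkm h2).mono (Nat.le_add_right _ _)))
    set X := MonoidAlgebra.of (ZMod p) G x
    set k' := MonoidAlgebra.of (ZMod p) G k
    set c' := MonoidAlgebra.of (ZMod p) G c
    have hle : n + m ≤ n - w + m + w := by omega
    have hle' : n + m ≤ n - w + (m + w : ℕ+) := by rw [PNat.add_coe]; omega
    have e1 : (k' - 1) * (b + (X - 1) * a') = (k' - 1) * b + (X - 1) * ((k' - 1) * a')
        + (X - 1) * ((c' - 1) * a' + (k' - 1) * ((c' - 1) * a'))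
        + ((c' - 1) * a' + (k' - 1) * ((c' - 1) * a')) := by
      have e2 : k' * (X * a') = X * (k' * (c' * a')) := by
        rw [← mul_assoc, hkx]; simp only [mul_assoc]
      simp only [sub_mul, mul_add, mul_sub, one_mul, e2]
      abel
    rw [e1]
    refine (((of_hasWeight (hb.sub_one_mul hk hkm)).add ?_).add ?_).add ?_
    · exact h1.sub_one_mul_succ.mono hle
    · exact h3.sub_one_mul_succ.mono (hle'.trans (Nat.le_add_right _ _))
    · exact h3.succ.mono hle'

theorem of_pow_mul [Fact p.Prime] (hx : x ^ p = 1) (ha : HornerWeight p F K x w p n a) (i : ℕ) :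
    HornerWeight p F K x w p n (MonoidAlgebra.of (ZMod p) G (x ^ i) * a) := by
  induction i with
  | zero => rwa [pow_zero, map_one, one_mul]
  | succ i ih =>
    have h := ((ih.sub_one_mul hx).mono (Nat.le_add_right _ _)).add ih
    rwa [sub_mul, one_mul, sub_add_cancel, ← mul_assoc, ← map_mul, ← pow_succ'] at h

/-- If every element of `L` is of the form `x ^ i k` with `k ∈ K`, and those of weight greater than
`w` lie in `K`, then the filtration defined by `L` is given by expansions in `x - 1` over the
filtration defined by `K`. -/
theorem of_hasWeight_of_le [hp : Fact p.Prime] {L : Subgroup G} {w : ℕ+} (hxp : x ^ p = 1)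
    (hx : x ∈ F.N w) (hK : ∀ k ∈ K, ⁅k⁻¹, x⁻¹⁆ ∈ K) (hKw : K ≤ F.N w)
    (hL : ∀ l ∈ L, ∃ i, ∃ k ∈ K, l = x ^ i * k) (hLK : ∀ l ∈ L, l ∈ F.N (w + 1) → l ∈ K)
    (ha : HasWeight p F L n a) : HornerWeight p F K x w p n a := by
  induction ha with
  | one =>
    obtain ⟨e, rfl⟩ := Nat.exists_eq_add_of_le' hp.out.pos
    exact of_hasWeight .one
  | @sub_one_mul l m n a hl hlm _ ih =>
    by_cases hmw : w + 1 ≤ m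
    · exact ih.sub_one_mul_of_mem hx hK (hLK l hl (F.antitone hmw hlm)) hlm
    · have hmw' : m ≤ w := by
        rw [not_le] at hmw
        exact PNat.lt_add_one_iff.1 hmw
      obtain ⟨i, k, hk, rfl⟩ := hL l hl
      have h1 := (ih.sub_one_mul_of_mem hx hK hk (F.antitone hmw' (hKw hk))).of_pow_mul hxp i
      have h2 : ∀ i : ℕ, HornerWeight p F K x w p (n + m)
          ((MonoidAlgebra.of (ZMod p) G (x ^ i) - 1) * a) := by
        intro i
        induction i with
        | zero => rw [pow_zero, map_one, sub_self, zero_mul]; exact zero _ _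
        | succ i ih' =>
          have h3 := ((ih.sub_one_mul hxp).mono (Nat.add_le_add_left hmw' n)).of_pow_mul hxp i
          have e1 : (MonoidAlgebra.of (ZMod p) G (x ^ (i + 1)) - 1) * a
              = MonoidAlgebra.of (ZMod p) G (x ^ i) * ((MonoidAlgebra.of (ZMod p) G x - 1) * a)
                + (MonoidAlgebra.of (ZMod p) G (x ^ i) - 1) * a := by
            rw [pow_succ, map_mul]; noncomm_ring
          rw [e1]
          exact h3.add ih'
      have e2 : (MonoidAlgebra.of (ZMod p) G (x ^ i * k) - 1) * a
          = MonoidAlgebra.of (ZMod p) G (x ^ i) * ((MonoidAlgebra.of (ZMod p) G k - 1) * a)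
            + (MonoidAlgebra.of (ZMod p) G (x ^ i) - 1) * a := by
        rw [map_mul]; noncomm_ring
      rw [e2]
      exact h1.add (h2 i)
  | of_succ _ ih => exact ih.mono (Nat.le_succ _)
  | zero => exact zero _ _
  | add _ _ ih ih' => exact ih.add ih'
  | smul r _ ih => exact ih.smul r

end HornerWeight
/-- If the powers `x, …, x ^ (p - 1)` lie outside `K`, then multiplication by `(x - 1) ^ (p - 1)`,
the sum of the powers of `x`, is injective on elements supported on `K`. -/
theorem eq_zero_of_sub_one_pow_mul_eq_zero [hp : Fact p.Prime] {K : Subgroup G} {x : G}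
    (hx : ∀ j, 0 < j → j < p → x ^ j ∉ K) {b : MonoidAlgebra (ZMod p) G}
    (hb : ∀ g ∉ K, b.coeff g = 0)
    (h : (MonoidAlgebra.of (ZMod p) G x - 1) ^ (p - 1) * b = 0) : b = 0 := by
  rw [sub_one_pow_pred_eq_geom_sum, Finset.sum_mul] at h
  ext g
  by_cases hg : g ∈ K
  · have h1 := congrArg (fun a => a.coeff g) h
    simp only [MonoidAlgebra.coeff_sum, Finsupp.finsetSum_apply] at h1
    rw [Finset.sum_eq_single 0] at h1
    · simpa using h1
    · intro j hj hj0
      have hxg : (x ^ j)⁻¹ * g ∉ K := fun h =>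
        hx j (Nat.pos_of_ne_zero hj0) (Finset.mem_range.1 hj)
          (by simpa using mul_mem hg (inv_mem h))
      rw [← map_pow, MonoidAlgebra.of_apply, MonoidAlgebra.coeff_single_mul_apply, hb _ hxg,
        mul_zero]
    · intro h0; exact absurd (Finset.mem_range.2 hp.out.pos) h0
  · rw [hb g hg]; simp

/-- The inductive step from `K` to the group generated by `K` and `x`: the two lowest coefficients
of the expansion of `x ^ i k - 1` in powers of `x - 1` are `k - 1` and `i k`. -/
theorem HornerWeight.hasWeight_sub_one [hp : Fact p.Prime] {K : Subgroup G} {x k : G} {w n i : ℕ}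
    (hxp : x ^ p = 1) (hx : ∀ j, 0 < j → j < p → x ^ j ∉ K) (hk : k ∈ K) (hi : i < p)
    (h : HornerWeight p F K x w p n (MonoidAlgebra.of (ZMod p) G (x ^ i * k) - 1)) :
    HasWeight p F K n (MonoidAlgebra.of (ZMod p) G k - 1) ∧ (w < n → i = 0) := by
  have : CharP (MonoidAlgebra (ZMod p) G) p :=
    charP_of_injective_algebraMap (algebraMap (ZMod p) _).injective p
  obtain ⟨q, hq⟩ := Nat.exists_eq_add_of_le' hp.out.two_le
  have h0 : HornerWeight p F K x w (q + 1 + 1) n (MonoidAlgebra.of (ZMod p) G (x ^ i * k) - 1) := by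
    have hq' : q + 1 + 1 = p := hq.symm
    rwa [hq']
  obtain ⟨b₀, a', hb₀, ⟨b₁, a'', hb₁, -, ha'⟩, ha⟩ := h0
  rw [map_mul, map_pow] at ha
  set X := MonoidAlgebra.of (ZMod p) G x with hX
  set k' := MonoidAlgebra.of (ZMod p) G k with hk'
  have hpow : (X - 1) ^ p = 0 := by
    rw [sub_pow_char_of_commute (p := p) (Commute.one_right _), ← map_pow, hxp, map_one, one_pow,
      sub_self]
  have hpow' : (X - 1) ^ (p - 1) * (X - 1) = 0 := by
    rw [← pow_succ, Nat.sub_add_cancel hp.out.one_le, hpow]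
  have hXi : ∀ i, (X - 1) ^ (p - 1) * X ^ i = (X - 1) ^ (p - 1) := by
    intro i
    induction i with
    | zero => simp
    | succ i ih =>
      rw [pow_succ, ← mul_assoc, ih]
      rwa [mul_sub, mul_one, sub_eq_zero] at hpow'
  have hk0 : ∀ g ∉ K, k'.coeff g = 0 := fun g hg => by
    classical
    rw [hk', MonoidAlgebra.of_apply, MonoidAlgebra.coeff_single, Finsupp.single_apply, if_neg]
    rintro rfl
    exact hg hk
  have hone : ∀ g ∉ K, (1 : MonoidAlgebra (ZMod p) G).coeff g = 0 := fun g hg =>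
    (HasWeight.one (F := F) (K := K)).coeff_eq_zero hg
  -- Multiplication by `(x - 1) ^ (p - 1)` kills all terms but the constant one and absorbs `x ^ i`.
  have hb : k' - 1 = b₀ := by
    rw [← sub_eq_zero]
    refine eq_zero_of_sub_one_pow_mul_eq_zero hx (fun g hg => ?_) ?_
    · simp [hk0 g hg, hone g hg, hb₀.coeff_eq_zero hg]
    · have h1 := congrArg (fun a => (X - 1) ^ (p - 1) * a) ha
      rw [mul_sub, mul_add, ← mul_assoc, ← mul_assoc, hXi, hpow', zero_mul, add_zero, mul_one] at h1
      rw [← hX, mul_sub, mul_sub, mul_one, h1, sub_self]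
  refine ⟨hb ▸ hb₀, fun hwn => ?_⟩
  -- The coefficient of `x - 1` is `i k`, whose augmentation is `i`.
  have hik : (i : MonoidAlgebra (ZMod p) G) * k' = b₁ := by
    rw [← sub_eq_zero]
    refine eq_zero_of_sub_one_pow_mul_eq_zero hx (fun g hg => ?_) ?_
    · rw [← nsmul_eq_mul, MonoidAlgebra.coeff_sub, MonoidAlgebra.coeff_smul, Finsupp.sub_apply,
        Finsupp.smul_apply, hk0 g hg, hb₁.coeff_eq_zero hg, smul_zero, sub_zero]
    · have h1 : (X ^ i - 1) * k' = (X - 1) * a' := by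
        have h2 : (X ^ i - 1) * k' = X ^ i * k' - 1 - (k' - 1) := by noncomm_ring
        rw [h2, ha, hb, add_sub_cancel_left]
      have h3 := congrArg (fun a => (X - 1) ^ (p - 2) * a) h1
      have hp1 : p - 1 = p - 2 + 1 := by omega
      have h4 : (X - 1) ^ (p - 1) * (i : MonoidAlgebra (ZMod p) G)
          = (X - 1) ^ (p - 2) * (X ^ i - 1) := by
        rw [← mul_geom_sum, ← mul_assoc, ← pow_succ, ← hp1, Finset.mul_sum,
          Finset.sum_congr rfl fun j _ => hXi j, Finset.sum_const, Finset.card_range,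
          nsmul_eq_mul, Nat.cast_comm]
      have h5 : (X - 1) ^ (p - 1) * b₁ = (X - 1) ^ (p - 2) * ((X - 1) * a') := by
        rw [← mul_assoc, ← pow_succ, ← hp1, ha', mul_add, ← mul_assoc _ _ a'', hpow', zero_mul,
          add_zero]
      rw [mul_sub, ← mul_assoc, h4, h5, mul_assoc, h3, sub_self]
  have haug := hb₁.augmentation_eq_zero (Nat.sub_ne_zero_of_lt hwn)
  rw [← hik, map_mul, map_natCast, MonoidAlgebra.lift_of, MonoidHom.one_apply, mul_one,
    ZMod.natCast_eq_zero_iff] at haug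
  exact Nat.eq_zero_of_dvd_of_lt haug hi

/-- Jennings' theorem in exponent `p`: an element `h` of `K` such that `h - 1` has weight at least
`n` belongs to the `n`-th term of the series. The proof is by induction on the order of `K`. -/
theorem mem_of_hasWeight_sub_one [hp : Fact p.Prime] [Finite G] (F : CentralSeries G)
    (hexp : ∀ g : G, g ^ p = 1) (K : Subgroup G) {n : ℕ+} {h : G} (hh : h ∈ K)
    (hw : HasWeight p F K n (MonoidAlgebra.of (ZMod p) G h - 1)) : h ∈ F.N n := by
  induction hc : Nat.card K using Nat.strong_induction_on generalizing K n h with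
  | _ c ih =>
  by_cases hall : ∀ w, K ≤ F.N w → K ≤ F.N (w + 1)
  · have : ∀ w, K ≤ F.N w := fun w => by
      induction w using PNat.recOn with
      | one => rw [F.one_eq_top]; exact le_top
      | succ w ih' => exact hall w ih'
    exact this n hh
  push Not at hall
  obtain ⟨w, hKw, hKw1⟩ := hall
  -- A maximal subgroup of `K` above `K ∩ N_{w + 1}`; it is normal since `K / (K ∩ N_{w + 1})` is
  -- abelian.
  obtain ⟨M, hM⟩ := (Set.toFinite {M : Subgroup G | K ⊓ F.N (w + 1) ≤ M ∧ M < K}).exists_maximal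
    ⟨K ⊓ F.N (w + 1), le_rfl, inf_lt_left.2 hKw1⟩
  obtain ⟨⟨hMw, hMK⟩, hmax⟩ := hM
  obtain ⟨x, hxK, hxM⟩ := SetLike.exists_of_lt hMK
  have hcomm : ∀ a ∈ K, ∀ b ∈ K, ⁅a, b⁆ ∈ M := fun a ha b hb => by
    refine hMw (Subgroup.mem_inf.2 ⟨?_, F.antitone ?_ (F.comm_mem (hKw ha) (hKw hb))⟩)
    · rw [commutatorElement_def]
      exact mul_mem (mul_mem (mul_mem ha hb) (inv_mem ha)) (inv_mem hb)
    · have : 1 ≤ w := one_le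
      gcongr
  have hconj : ∀ a ∈ K, ∀ b ∈ M, a * b * a⁻¹ ∈ M := fun a ha b hb => by
    have h1 : a * b * a⁻¹ = ⁅a, b⁆ * b := by simp [commutatorElement_def]
    rw [h1]
    exact mul_mem (hcomm a ha b (hMK.le hb)) hb
  have hinv : x⁻¹ = x ^ (p - 1) := by
    rw [inv_eq_iff_mul_eq_one, ← pow_succ', Nat.sub_add_cancel hp.out.one_le, hexp]
  let S : Subgroup G :=
    { carrier := {g | ∃ i : ℕ, ∃ k ∈ M, g = x ^ i * k}
      one_mem' := ⟨0, 1, one_mem _, by simp⟩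
      mul_mem' := by
        rintro _ _ ⟨i, k, hk, rfl⟩ ⟨j, l, hl, rfl⟩
        refine ⟨i + j, (x ^ j)⁻¹ * k * (x ^ j)⁻¹⁻¹ * l,
          mul_mem (hconj _ (inv_mem (pow_mem hxK j)) k hk) hl, ?_⟩
        rw [pow_add]; group
      inv_mem' := by
        rintro _ ⟨i, k, hk, rfl⟩
        refine ⟨(p - 1) * i, x ^ i * k⁻¹ * (x ^ i)⁻¹, hconj _ (pow_mem hxK i) _ (inv_mem hk), ?_⟩
        rw [pow_mul, ← hinv]; simp [mul_assoc] }
  have hS : ∀ l ∈ K, l ∈ S := by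
    by_contra hlS
    have hSK : S < K := by
      refine lt_of_le_of_ne ?_ fun h1 => hlS fun l hl => h1 ▸ hl
      rintro _ ⟨i, k, hk, rfl⟩
      exact mul_mem (pow_mem hxK i) (hMK.le hk)
    have hMS : M ≤ S := fun k hk => ⟨0, k, hk, by simp⟩
    exact hxM (hmax ⟨hMw.trans hMS, hSK⟩ hMS ⟨1, 1, one_mem _, by simp⟩)
  have hxj : ∀ j, 0 < j → j < p → x ^ j ∉ M := fun j hj hjp hxjM => by
    have hcop : (orderOf x).Coprime j :=
      Nat.Coprime.coprime_dvd_left (orderOf_dvd_of_pow_eq_one (hexp x))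
        (Nat.coprime_of_lt_prime hj.ne' hjp hp.out)
    obtain ⟨m, hm⟩ := exists_pow_eq_self_of_coprime hcop.symm
    exact hxM (hm ▸ pow_mem hxjM m)
  obtain ⟨i, k, hk, rfl⟩ := hS h hh
  have hi : x ^ i = x ^ (i % p) := by
    conv_lhs => rw [← Nat.div_add_mod i p, pow_add, pow_mul, hexp, one_pow, one_mul]
  rw [hi] at hw ⊢
  have hexpand := HornerWeight.of_hasWeight_of_le (hexp x) (hKw hxK)
    (fun k hk => hcomm _ (inv_mem (hMK.le hk)) _ (inv_mem hxK)) (hMK.le.trans hKw) hS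
    (fun l hl hl' => hMw ⟨hl, hl'⟩) hw
  obtain ⟨h1, h2⟩ := hexpand.hasWeight_sub_one (hexp x) hxj hk (Nat.mod_lt _ hp.out.pos)
  have hkn : k ∈ F.N n := ih _ (by
    rw [← hc]
    exact Set.ncard_lt_ncard hMK (Set.toFinite _)) M hk h1 rfl
  by_cases hwn : (w : ℕ) < n
  · rw [h2 hwn, pow_zero, one_mul]; exact hkn
  · have hnw : n ≤ w := by rw [← PNat.coe_le_coe]; omega
    exact mul_mem (pow_mem (F.antitone hnw (hKw hxK)) _) hkn

end Jennings

/-! ### Dimension subgroups in exponent `p` -/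

section Dimension

theorem map_mem_augmentationIdeal_pow {R : Type*} [CommRing R] {G H : Type*} [Group G] [Group H]
    (f : G →* H) {n : ℕ} {a : MonoidAlgebra R G} (ha : a ∈ augmentationIdeal R G ^ n) :
    MonoidAlgebra.lift R (MonoidAlgebra R H) G ((MonoidAlgebra.of R H).comp f) a
      ∈ augmentationIdeal R H ^ n := by
  induction n generalizing a with
  | zero => simp [Submodule.pow_zero]
  | succ n ih =>
    rw [Ideal.IsTwoSided.pow_add, Submodule.pow_one] at ha ⊢
    refine Submodule.mul_induction_on ha (fun x hx y hy => ?_) fun x y hx hy => ?_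
    · rw [map_mul]
      refine Ideal.mul_mem_mul (ih hx) ?_
      have hy' : MonoidAlgebra.lift R R G 1 y = 0 := hy
      have hcomp : (MonoidAlgebra.lift R R H 1).comp (MonoidAlgebra.lift R (MonoidAlgebra R H) G
          ((MonoidAlgebra.of R H).comp f)) = MonoidAlgebra.lift R R G 1 :=
        MonoidAlgebra.algHom_ext (fun g => by simp) (by ext)
      have h := DFunLike.congr_fun hcomp y
      rw [hy'] at h
      exact h
    · rw [map_add]; exact add_mem hx hy

theorem map_mem_dimensionSubgroup (R : Type*) [CommRing R] {G H : Type*} [Group G] [Group H]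
    (f : G →* H) {n : ℕ} {g : G} (hg : g ∈ dimensionSubgroup R G n) :
    f g ∈ dimensionSubgroup R H n := by
  rw [mem_dimensionSubgroup] at *
  simpa using map_mem_augmentationIdeal_pow f hg

/-- In a finite group of exponent `p` the dimension subgroups are the terms of the lower central
series. -/
theorem dimensionSeries_le_lowerSeries (p : ℕ) [Fact p.Prime] {G : Type*} [Group G] [Finite G]
    (hexp : ∀ g : G, g ^ p = 1) (n : ℕ+) :
    (dimensionSeries (ZMod p) G).N n ≤ (lowerSeries G).N n := by
  intro g hg
  have hg' : 1 - MonoidAlgebra.of (ZMod p) G g ∈ augmentationIdeal (ZMod p) G ^ (n : ℕ) := hg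
  refine mem_of_hasWeight_sub_one (lowerSeries G) hexp ⊤ (Subgroup.mem_top g)
    (hasWeight_of_mem_augmentationIdeal_pow (lowerSeries G) ?_)
  rw [← neg_sub]
  exact neg_mem hg'

/-- In a pro-`p` group of exponent `p` the closed Zassenhaus series is the closed lower central
series. This reduces to the finite quotients. -/
theorem zassenhausSeries_le (p : ℕ) [Fact p.Prime] {G : Type*} [Group G] [TopologicalSpace G]
    [IsTopologicalGroup G] (hG : IsProP p G) (hexp : ∀ g : G, g ^ p = 1) (n : ℕ+) :
    (zassenhausSeries p G).N n ≤ (magnusSeries G).N n := by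
  have := hG.compactSpace
  have := hG.totallyDisconnectedSpace
  refine Subgroup.topologicalClosure_minimal _ ?_ (Subgroup.isClosed_topologicalClosure _)
  intro g hg
  change g ∈ closure (((lowerSeries G).N n : Subgroup G) : Set G)
  rw [mem_closure_iff]
  intro V hV hgV
  obtain ⟨U, hU⟩ := ProfiniteGrp.exist_openNormalSubgroup_sub_open_nhds_of_one
    (U := (fun y => g * y) ⁻¹' V) (hV.preimage (continuous_const_mul g)) (by simpa using hgV)
  have : U.toSubgroup.Normal := U.isNormal'
  have : Finite (G ⧸ U.toSubgroup) := Subgroup.quotient_finite_of_isOpen _ U.isOpen'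
  have h1 := dimensionSeries_le_lowerSeries p (G := G ⧸ U.toSubgroup)
    (fun a => by
      obtain ⟨a, rfl⟩ := QuotientGroup.mk_surjective a
      rw [← QuotientGroup.mk_pow, hexp, QuotientGroup.mk_one]) n
    (map_mem_dimensionSubgroup (ZMod p) (QuotientGroup.mk' U.toSubgroup) hg)
  have h2 : (lowerSeries (G ⧸ U.toSubgroup)).N n
      = ((lowerSeries G).N n).map (QuotientGroup.mk' U.toSubgroup) := by
    change _ = ((⊤ : Subgroup G).lowerCentralSeries n.natPred).map _
    rw [Subgroup.map_lowerCentralSeries, Subgroup.map_top_of_surjective _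
      (QuotientGroup.mk'_surjective _)]
    rfl
  rw [h2] at h1
  obtain ⟨y, hy, hyg⟩ := h1
  refine ⟨y, ?_, hy⟩
  have h3 : g⁻¹ * y ∈ U := QuotientGroup.eq.1 hyg.symm
  simpa using hU h3

end Dimension

/-! ### Polarization -/

section Polarization

/-- The Möbius coefficient at the full set of a function on subsets which is given as a sum over
subsets. -/
theorem sum_neg_one_pow_mul_sum_powerset {ι A : Type*} [Fintype ι] [DecidableEq ι] [Ring A]
    (c : Finset ι → A) :
    ∑ S : Finset ι, (-1 : A) ^ (Sᶜ).card * ∑ T ∈ S.powerset, c T = c Finset.univ := by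
  have h : ∀ T : Finset ι, ∑ S : Finset ι, (if T ⊆ S then (-1 : A) ^ (Sᶜ).card * c T else 0)
      = if T = Finset.univ then c T else 0 := by
    intro T
    rw [← Finset.sum_filter, ← Finset.sum_mul]
    have h1 : ∑ S with T ⊆ S, (-1 : A) ^ (Sᶜ).card = ∑ R ∈ Tᶜ.powerset, (-1 : A) ^ R.card := by
      refine Finset.sum_nbij' (fun S => Sᶜ) (fun R => Rᶜ) ?_ ?_ ?_ ?_ ?_
      · intro S hS
        simpa using (Finset.mem_filter.1 hS).2
      · intro R hR
        rw [Finset.mem_powerset] at hR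
        simpa [Finset.subset_compl_comm] using hR
      · simp
      · simp
      · simp
    have h2 : ∑ R ∈ Tᶜ.powerset, (-1 : A) ^ R.card = if T = Finset.univ then 1 else 0 := by
      have h3 := congrArg (Int.cast : ℤ → A) (Finset.sum_powerset_neg_one_pow_card (x := Tᶜ))
      simpa [Finset.compl_eq_empty_iff] using h3
    rw [h1, h2]
    split_ifs <;> simp
  calc ∑ S : Finset ι, (-1 : A) ^ (Sᶜ).card * ∑ T ∈ S.powerset, c T
      = ∑ S : Finset ι, ∑ T : Finset ι, if T ⊆ S then (-1 : A) ^ (Sᶜ).card * c T else 0 := by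
        refine Finset.sum_congr rfl fun S _ => ?_
        rw [Finset.mul_sum, ← Finset.sum_filter]
        exact Finset.sum_congr (by ext; simp) fun _ _ => rfl
    _ = c Finset.univ := by
        rw [Finset.sum_comm, Finset.sum_congr rfl fun T _ => h T]
        simp

/-- The polarization identity for the `m`-th power in a noncommutative ring. -/
theorem sum_perm_prod_eq_sum_neg_one_pow {A : Type*} [Ring A] {m : ℕ} (U : Fin m → A) :
    ∑ σ : Equiv.Perm (Fin m), (List.ofFn fun i => U (σ i)).prod
      = ∑ S : Finset (Fin m), (-1 : A) ^ (Sᶜ).card * (∑ i ∈ S, U i) ^ m := by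
  have h : ∀ S : Finset (Fin m), (∑ i ∈ S, U i) ^ m = ∑ T ∈ S.powerset,
      ∑ f : Fin m → Fin m with Finset.univ.image f = T, (List.ofFn fun i => U (f i)).prod := by
    intro S
    have h1 := (MultilinearMap.mkPiAlgebraFin ℤ m A).map_sum_finset (fun _ i => U i) (fun _ => S)
    rw [MultilinearMap.mkPiAlgebraFin_apply_const] at h1
    simp only [MultilinearMap.mkPiAlgebraFin_apply] at h1
    have hmaps : ∀ f ∈ Fintype.piFinset fun _ : Fin m => S, Finset.univ.image f ∈ S.powerset :=
      fun f hf => by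
        rw [Fintype.mem_piFinset] at hf
        rw [Finset.mem_powerset, Finset.image_subset_iff]
        exact fun i _ => hf i
    rw [h1, ← Finset.sum_fiberwise_of_maps_to hmaps]
    refine Finset.sum_congr rfl fun T hT => Finset.sum_congr ?_ fun _ _ => rfl
    ext f
    simp only [Finset.mem_filter, Fintype.mem_piFinset, Finset.mem_univ, true_and,
      and_iff_right_iff_imp]
    rintro rfl i
    exact Finset.mem_powerset.1 hT (Finset.mem_image_of_mem f (Finset.mem_univ i))
  simp only [h, sum_neg_one_pow_mul_sum_powerset]
  symm
  refine Finset.sum_bij' (fun f hf => Equiv.ofBijective f ?_) (fun σ _ => σ) ?_ ?_ ?_ ?_ ?_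
  · have hs : Function.Surjective f := fun i => by
      have hi : i ∈ Finset.univ.image f := by
        rw [(Finset.mem_filter.1 hf).2]; exact Finset.mem_univ i
      simpa using hi
    exact Finite.surjective_iff_bijective.1 hs
  · simp
  · intro σ _
    simp [Finset.image_univ_equiv]
  · intro f _; rfl
  · intro σ _; ext; rfl
  · intro f _; rfl

end Polarization

/-! ### Functions on subsets with filtered Möbius coefficients -/

/-- A decreasing multiplicative filtration of a ring by additive subgroups. -/
structure RingFiltration (A : Type*) [Ring A] where
  /-- The terms of the filtration. -/
  I : ℕ → AddSubgroup A
  one_mem : 1 ∈ I 0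
  antitone : Antitone I
  mul_mem : ∀ {i j a b}, a ∈ I i → b ∈ I j → a * b ∈ I (i + j)

section Moebius

variable {A : Type*} [Ring A] {ι : Type*} (I : RingFiltration A)
  (n : ι → ℕ)

/-- `IsMoebius I n k d φ` says that `φ S = ∑_{T ⊆ S} c_T` with coefficients
`c_T` in the filtration step `∑_{i ∈ T} n_i + d + (k - |T|)`. Thus the variable of index `i` counts
with weight `n_i`, a constant factor contributes to `d`, and `k` is a lower bound for the number of
factors that involve variables: a monomial in which `k` factors only involve a set `T` of fewer
than `k` variables has repeated variables, which accounts for the summand `k - |T|`. -/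
def IsMoebius (k d : ℕ) (φ : Finset ι → A) : Prop :=
  ∃ c : Finset ι → A, (∀ T, c T ∈ I.I (∑ i ∈ T, n i + d + (k - T.card))) ∧
    ∀ S, φ S = ∑ T ∈ S.powerset, c T

variable {I n} {k k' d d' : ℕ} {φ ψ : Finset ι → A}

namespace IsMoebius

theorem mono (h : IsMoebius I n k d φ) (hk : k' ≤ k) (hd : d' ≤ d) : IsMoebius I n k' d' φ := by
  obtain ⟨c, hc, h⟩ := h
  exact ⟨c, fun T => I.antitone (by omega) (hc T), h⟩

theorem add (h : IsMoebius I n k d φ) (h' : IsMoebius I n k d ψ) :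
    IsMoebius I n k d (fun S => φ S + ψ S) := by
  obtain ⟨c, hc, h⟩ := h
  obtain ⟨c', hc', h'⟩ := h'
  exact ⟨fun T => c T + c' T, fun T => add_mem (hc T) (hc' T),
    fun S => by simp only [h, h', Finset.sum_add_distrib]⟩

theorem neg (h : IsMoebius I n k d φ) : IsMoebius I n k d (fun S => -φ S) := by
  obtain ⟨c, hc, h⟩ := h
  exact ⟨fun T => -c T, fun T => neg_mem (hc T), fun S => by simp only [h, Finset.sum_neg_distrib]⟩

theorem sub (h : IsMoebius I n k d φ) (h' : IsMoebius I n k d ψ) :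
    IsMoebius I n k d (fun S => φ S - ψ S) := by
  simpa only [sub_eq_add_neg] using h.add h'.neg

theorem zero : IsMoebius I n k d (fun _ => 0) :=
  ⟨fun _ => 0, fun _ => zero_mem _, fun S => by simp⟩

variable [DecidableEq ι]

theorem const {a : A} (ha : a ∈ I.I d) : IsMoebius I n 0 d (fun _ => a) :=
  ⟨fun T => if T = ∅ then a else 0, fun T => by
    dsimp only
    split_ifs with hT
    · subst hT; simpa using ha
    · exact zero_mem _, fun S => by simp⟩

theorem variable_mem {a : A} {i : ι} (ha : a ∈ I.I (n i)) :
    IsMoebius I n 1 0 (fun S => if i ∈ S then a else 0) :=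
  ⟨fun T => if T = {i} then a else 0, fun T => by
    dsimp only
    split_ifs with hT
    · subst hT; simpa using ha
    · exact zero_mem _, fun S => by
    simp⟩

/-- Orders of products add up. If `T` and `T'` overlap, then the weights of `T ∩ T'`, which are
positive, make up for `|T ∪ T'|` being less than `|T| + |T'|`. -/
theorem mul (hn : ∀ i, 0 < n i) (h : IsMoebius I n k d φ) (h' : IsMoebius I n k' d' ψ) :
    IsMoebius I n (k + k') (d + d') (fun S => φ S * ψ S) := by
  obtain ⟨c, hc, h⟩ := h
  obtain ⟨c', hc', h'⟩ := h'
  refine ⟨fun R => ∑ q ∈ (R.powerset ×ˢ R.powerset) with q.1 ∪ q.2 = R, c q.1 * c' q.2,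
    fun R => ?_, fun S => ?_⟩
  · refine sum_mem fun q hq => ?_
    obtain ⟨-, rfl⟩ := Finset.mem_filter.1 hq
    refine I.antitone ?_ (I.mul_mem (hc q.1) (hc' q.2))
    have h1 := Finset.sum_union_inter (s₁ := q.1) (s₂ := q.2) (f := n)
    have h2 := Finset.card_union_add_card_inter q.1 q.2
    have h3 : (q.1 ∩ q.2).card ≤ ∑ i ∈ q.1 ∩ q.2, n i := by
      rw [Finset.card_eq_sum_ones]
      exact Finset.sum_le_sum fun i _ => hn i
    omega
  · dsimp only
    rw [h, h', Finset.sum_mul_sum, ← Finset.sum_product']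
    have hmaps : ∀ q ∈ S.powerset ×ˢ S.powerset, q.1 ∪ q.2 ∈ S.powerset := fun q hq => by
      simp only [Finset.mem_product, Finset.mem_powerset] at hq ⊢
      exact Finset.union_subset hq.1 hq.2
    rw [← Finset.sum_fiberwise_of_maps_to hmaps]
    refine Finset.sum_congr rfl fun R hR => Finset.sum_congr ?_ fun _ _ => rfl
    ext q
    simp only [Finset.mem_filter, Finset.mem_product, Finset.mem_powerset] at hR ⊢
    constructor
    · rintro ⟨-, rfl⟩
      exact ⟨⟨Finset.subset_union_left, Finset.subset_union_right⟩, rfl⟩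
    · rintro ⟨⟨h1, h2⟩, h3⟩
      exact ⟨⟨h1.trans hR, h2.trans hR⟩, h3⟩

theorem pow (hn : ∀ i, 0 < n i) (h : IsMoebius I n 0 0 φ) (r : ℕ) :
    IsMoebius I n 0 0 (fun S => φ S ^ r) := by
  induction r with
  | zero => simpa using const I.one_mem
  | succ r ih => simpa only [pow_succ] using ih.mul hn h

/-- The alternating sum over all subsets picks out the terms that involve all variables. -/
theorem sum_mem_top [Fintype ι] (h : IsMoebius I n k d φ) :
    ∑ S : Finset ι, (-1 : A) ^ (Sᶜ).card * φ S
      ∈ I.I (∑ i, n i + d + (k - Fintype.card ι)) := by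
  obtain ⟨c, hc, h⟩ := h
  simp only [h, sum_neg_one_pow_mul_sum_powerset]
  exact hc Finset.univ

end IsMoebius

end Moebius

/-! ### The multilinear Engel identity in the group algebra -/

section GroupAlgebra

variable {p : ℕ} {G : Type*} [Group G]

/-- The powers of the augmentation ideal as a filtration of the group algebra. -/
def augmentationFiltration (p : ℕ) (G : Type*) [Group G] :
    RingFiltration (MonoidAlgebra (ZMod p) G) where
  I n := (augmentationIdeal (ZMod p) G ^ n).toAddSubgroup
  one_mem := by simp [Submodule.pow_zero]
  antitone _ _ h := fun _ ha => Ideal.pow_le_pow_right h ha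
  mul_mem {i j a b} ha hb := by
    change a * b ∈ augmentationIdeal (ZMod p) G ^ (i + j)
    rw [Ideal.IsTwoSided.pow_add]
    exact Ideal.mul_mem_mul ha hb

theorem mem_augmentationFiltration {n : ℕ} {a : MonoidAlgebra (ZMod p) G} :
    a ∈ (augmentationFiltration p G).I n ↔ a ∈ augmentationIdeal (ZMod p) G ^ n := Iff.rfl

theorem of_sub_one_mem_iff {n : ℕ} {g : G} :
    MonoidAlgebra.of (ZMod p) G g - 1 ∈ (augmentationFiltration p G).I n
      ↔ g ∈ dimensionSubgroup (ZMod p) G n := by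
  rw [mem_augmentationFiltration, mem_dimensionSubgroup, ← neg_sub, neg_mem_iff]

section Subsets

variable {ι : Type*} [DecidableEq ι] {n : ι → ℕ} {z : ι → G}

/-- The product over a list of indices of those `z i` with `i ∈ S`. -/
def subsetProd (z : ι → G) (l : List ι) (S : Finset ι) : G :=
  (l.map fun i => if i ∈ S then z i else 1).prod

/-- The product of the `z i = 1 + u i` with `i ∈ S` is `1 + ∑ u i`, up to terms that involve at least
two factors. -/
theorem isMoebius_subsetProd (hn : ∀ i, 0 < n i)
    (hz : ∀ i, z i ∈ dimensionSubgroup (ZMod p) G (n i)) (l : List ι) :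
    IsMoebius (augmentationFiltration p G) n 1 0
      (fun S => MonoidAlgebra.of (ZMod p) G (subsetProd z l S) - 1) ∧
    IsMoebius (augmentationFiltration p G) n 1 0
      (fun S => (l.map fun i => if i ∈ S then MonoidAlgebra.of (ZMod p) G (z i) - 1 else 0).sum) ∧
    IsMoebius (augmentationFiltration p G) n 2 0
      (fun S => MonoidAlgebra.of (ZMod p) G (subsetProd z l S) - 1
        - (l.map fun i => if i ∈ S then MonoidAlgebra.of (ZMod p) G (z i) - 1 else 0).sum) := by
  induction l with
  | nil =>
    have h : ∀ S, MonoidAlgebra.of (ZMod p) G (subsetProd z [] S) = 1 := fun S => map_one _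
    simp only [h, sub_self, List.map_nil, List.sum_nil]
    exact ⟨.zero, .zero, .zero⟩
  | cons i l ih =>
    obtain ⟨h1, h2, h3⟩ := ih
    have hi : IsMoebius (augmentationFiltration p G) n 1 0
        (fun S => if i ∈ S then MonoidAlgebra.of (ZMod p) G (z i) - 1 else 0) :=
      .variable_mem (of_sub_one_mem_iff.2 (hz i))
    have hmul := hi.mul hn h1
    have e : ∀ S, MonoidAlgebra.of (ZMod p) G (subsetProd z (i :: l) S) - 1
        = (MonoidAlgebra.of (ZMod p) G (subsetProd z l S) - 1)
          + (if i ∈ S then MonoidAlgebra.of (ZMod p) G (z i) - 1 else 0)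
          + (if i ∈ S then MonoidAlgebra.of (ZMod p) G (z i) - 1 else 0)
            * (MonoidAlgebra.of (ZMod p) G (subsetProd z l S) - 1) := by
      intro S
      rw [subsetProd, List.map_cons, List.prod_cons, ← subsetProd]
      split_ifs
      · rw [map_mul]; noncomm_ring
      · rw [one_mul, zero_mul, add_zero, add_zero]
    simp only [List.map_cons, List.sum_cons]
    refine ⟨?_, hi.add h2, ?_⟩
    · simp only [e]
      exact (h1.add hi).add (hmul.mono (by omega) le_rfl)
    · have h := h3.add hmul
      simp only [e]
      convert h using 2 with S
      abel

end Subsets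

variable [hp : Fact p.Prime]

/-- Conjugation by `g` as a linear endomorphism of the group algebra. -/
def conjEnd (p : ℕ) [Fact p.Prime] (g : G) : Module.End (ZMod p) (MonoidAlgebra (ZMod p) G) :=
  LinearMap.mulLeft (ZMod p) (MonoidAlgebra.of (ZMod p) G g)
    * LinearMap.mulRight (ZMod p) (MonoidAlgebra.of (ZMod p) G g⁻¹)

theorem conjEnd_apply (g : G) (a : MonoidAlgebra (ZMod p) G) :
    conjEnd p g a = MonoidAlgebra.of (ZMod p) G g * (a * MonoidAlgebra.of (ZMod p) G g⁻¹) := rfl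

theorem conjEnd_pow_apply (g : G) (k : ℕ) (a : MonoidAlgebra (ZMod p) G) :
    (conjEnd p g ^ k) a
      = MonoidAlgebra.of (ZMod p) G (g ^ k) * (a * MonoidAlgebra.of (ZMod p) G (g ^ k)⁻¹) := by
  induction k with
  | zero => rw [pow_zero, pow_zero, inv_one, map_one, mul_one, one_mul, Module.End.one_apply]
  | succ k ih =>
    rw [pow_succ', Module.End.mul_apply, ih, conjEnd_apply, pow_succ' g, mul_inv_rev, map_mul,
      map_mul]
    simp only [mul_assoc]

variable (p G) in
/-- The inner derivation `b ↦ a b - b a` of the group algebra, linear in `a`. -/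
def innerEnd : MonoidAlgebra (ZMod p) G →ₗ[ZMod p] Module.End (ZMod p) (MonoidAlgebra (ZMod p) G) :=
  LinearMap.mul (ZMod p) _ - (LinearMap.mul (ZMod p) _).flip

theorem innerEnd_apply (a b : MonoidAlgebra (ZMod p) G) : innerEnd p G a b = a * b - b * a := rfl

variable {ι : Type*} [DecidableEq ι] {n : ι → ℕ} {d : ℕ} {h : Finset ι → G} {x : G}

/-- If `h` and `x` have exponent `p` then `∏_{k < p} h ^ k x h ^ {-k} = (x h) ^ p h ^ {-p} = 1`.
Expanding the product shows that the sum of the conjugates of `x - 1` is a sum of products of at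
least two of them. -/
theorem isMoebius_sum_conjEnd (hexp : ∀ g : G, g ^ p = 1) (hn : ∀ i, 0 < n i)
    (hh : IsMoebius (augmentationFiltration p G) n 0 0
      (fun S => MonoidAlgebra.of (ZMod p) G (h S)))
    (hx : x ∈ dimensionSubgroup (ZMod p) G d) :
    IsMoebius (augmentationFiltration p G) n 0 (d + d) (fun S =>
      ∑ k ∈ Finset.range p, (conjEnd p (h S) ^ k) (MonoidAlgebra.of (ZMod p) G x - 1)) := by
  have hinv : ∀ g : G, g⁻¹ = g ^ (p - 1) := fun g => by
    rw [inv_eq_iff_mul_eq_one, ← pow_succ', Nat.sub_add_cancel hp.out.one_le, hexp]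
  have hv : ∀ k, IsMoebius (augmentationFiltration p G) n 0 d
      (fun S => (conjEnd p (h S) ^ k) (MonoidAlgebra.of (ZMod p) G x - 1)) := by
    intro k
    have h1 := (hh.pow hn k).mul hn ((IsMoebius.const (of_sub_one_mem_iff.2 hx)).mul hn
      ((hh.pow hn k).pow hn (p - 1)))
    simp only [zero_add, add_zero] at h1
    simpa only [conjEnd_pow_apply, hinv, map_pow] using h1
  have key : ∀ r, IsMoebius (augmentationFiltration p G) n 0 d
        (fun S => MonoidAlgebra.of (ZMod p) G ((x * h S) ^ r * (h S ^ r)⁻¹) - 1) ∧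
      IsMoebius (augmentationFiltration p G) n 0 (d + d)
        (fun S => MonoidAlgebra.of (ZMod p) G ((x * h S) ^ r * (h S ^ r)⁻¹) - 1 -
          ∑ k ∈ Finset.range r, (conjEnd p (h S) ^ k) (MonoidAlgebra.of (ZMod p) G x - 1)) := by
    intro r
    induction r with
    | zero =>
      simp only [pow_zero, inv_one, mul_one, map_one, sub_self, Finset.range_zero,
        Finset.sum_empty]
      exact ⟨.zero, .zero⟩
    | succ r ih =>
      obtain ⟨h1, h2⟩ := ih
      have e : ∀ S, MonoidAlgebra.of (ZMod p) G ((x * h S) ^ (r + 1) * (h S ^ (r + 1))⁻¹)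
          = MonoidAlgebra.of (ZMod p) G ((x * h S) ^ r * (h S ^ r)⁻¹)
            * (1 + (conjEnd p (h S) ^ r) (MonoidAlgebra.of (ZMod p) G x - 1)) := by
        intro S
        have e1 : 1 + (conjEnd p (h S) ^ r) (MonoidAlgebra.of (ZMod p) G x - 1)
            = MonoidAlgebra.of (ZMod p) G (h S ^ r * x * (h S ^ r)⁻¹) := by
          rw [conjEnd_pow_apply, sub_mul, one_mul, mul_sub, ← map_mul, ← map_mul, ← map_mul,
            mul_inv_cancel, map_one, mul_assoc, add_sub_cancel]
        rw [e1, ← map_mul]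
        congr 1
        rw [pow_succ, pow_succ]
        group
      have hmul := h1.mul hn (hv r)
      simp only [e]
      constructor
      · convert (h1.add (hv r)).add (hmul.mono (Nat.zero_le _) (Nat.le_add_right d d)) using 2
        noncomm_ring
      · convert h2.add (hmul.mono le_rfl le_rfl) using 2
        rw [Finset.sum_range_succ]
        noncomm_ring
  have h3 := (key p).2.neg
  simpa only [hexp, inv_one, mul_one, map_one, sub_self, zero_sub, neg_neg] using h3

/-- Up to terms of higher order, `conj h - 1` is the inner derivation of `s` when `h = 1 + s` up to
terms of higher order. -/
theorem isMoebius_conjEnd_sub_one_pow_sub_ad_pow (hexp : ∀ g : G, g ^ p = 1) (hn : ∀ i, 0 < n i)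
    {s : Finset ι → MonoidAlgebra (ZMod p) G}
    (hh : IsMoebius (augmentationFiltration p G) n 1 0
      (fun S => MonoidAlgebra.of (ZMod p) G (h S) - 1))
    (hs : IsMoebius (augmentationFiltration p G) n 1 0 s)
    (hhs : IsMoebius (augmentationFiltration p G) n 2 0
      (fun S => MonoidAlgebra.of (ZMod p) G (h S) - 1 - s S))
    {a : MonoidAlgebra (ZMod p) G} (ha : a ∈ (augmentationFiltration p G).I d) (r : ℕ) :
    IsMoebius (augmentationFiltration p G) n r d
      (fun S => ((conjEnd p (h S) - 1) ^ r) a) ∧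
    IsMoebius (augmentationFiltration p G) n (r + 1) d
      (fun S => ((conjEnd p (h S) - 1) ^ r) a
        - (innerEnd p G (s S) ^ r) a) := by
  have hh0 : IsMoebius (augmentationFiltration p G) n 0 0
      (fun S => MonoidAlgebra.of (ZMod p) G (h S)) := by
    have h1 := (hh.mono (Nat.zero_le 1) le_rfl).add
      (IsMoebius.const (augmentationFiltration p G).one_mem)
    simpa only [sub_add_cancel] using h1
  have hinv : ∀ g : G, g⁻¹ = g ^ (p - 1) := fun g => by
    rw [inv_eq_iff_mul_eq_one, ← pow_succ', Nat.sub_add_cancel hp.out.one_le, hexp]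
  have hhi : IsMoebius (augmentationFiltration p G) n 0 0
      (fun S => MonoidAlgebra.of (ZMod p) G (h S)⁻¹) := by
    simpa only [hinv, map_pow] using hh0.pow hn (p - 1)
  have hhi1 : IsMoebius (augmentationFiltration p G) n 1 0
      (fun S => MonoidAlgebra.of (ZMod p) G (h S)⁻¹ - 1) := by
    have h1 := (hh.mul hn hhi).neg
    convert h1 using 2 with S
    rw [sub_mul, ← map_mul, mul_inv_cancel, map_one, one_mul, neg_sub]
  induction r with
  | zero =>
    simp only [pow_zero, Module.End.one_apply, sub_self]
    exact ⟨.const ha, .zero⟩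
  | succ r ih =>
    obtain ⟨h1, h2⟩ := ih
    have hD : ∀ S b, (conjEnd p (h S) - 1) b
        = ((MonoidAlgebra.of (ZMod p) G (h S) - 1) * b
          - b * (MonoidAlgebra.of (ZMod p) G (h S) - 1)) * MonoidAlgebra.of (ZMod p) G (h S)⁻¹ := by
      intro S b
      have e1 : MonoidAlgebra.of (ZMod p) G (h S) * MonoidAlgebra.of (ZMod p) G (h S)⁻¹ = 1 := by
        rw [← map_mul, mul_inv_cancel, map_one]
      have e2 : (MonoidAlgebra.of (ZMod p) G (h S) - 1) * b
          - b * (MonoidAlgebra.of (ZMod p) G (h S) - 1)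
          = MonoidAlgebra.of (ZMod p) G (h S) * b - b * MonoidAlgebra.of (ZMod p) G (h S) := by
        noncomm_ring
      rw [LinearMap.sub_apply, conjEnd_apply, Module.End.one_apply, e2, sub_mul, mul_assoc b, e1,
        mul_one, mul_assoc]
    have hφ : IsMoebius (augmentationFiltration p G) n (r + 1) d
        (fun S => (MonoidAlgebra.of (ZMod p) G (h S) - 1) * ((conjEnd p (h S) - 1) ^ r) a
          - ((conjEnd p (h S) - 1) ^ r) a * (MonoidAlgebra.of (ZMod p) G (h S) - 1)) :=
      ((hh.mul hn h1).mono (by omega) (by omega)).sub ((h1.mul hn hh).mono (by omega) (by omega))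
    constructor
    · simp only [pow_succ', Module.End.mul_apply, hD]
      exact (hφ.mul hn hhi).mono (by omega) (by omega)
    · have t1 := (hφ.mul hn hhi1).mono (k' := r + 1 + 1) (d' := d) (by omega) (by omega)
      have t2 := ((hhs.mul hn h1).mono (k' := r + 1 + 1) (d' := d) (by omega) (by omega)).sub
        ((h1.mul hn hhs).mono (by omega) (by omega))
      have t3 := ((hs.mul hn h2).mono (k' := r + 1 + 1) (d' := d) (by omega) (by omega)).sub
        ((h2.mul hn hs).mono (by omega) (by omega))
      convert (t1.add t2).add t3 using 2 with S
      rw [pow_succ', Module.End.mul_apply, hD, pow_succ', Module.End.mul_apply, innerEnd_apply]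
      noncomm_ring

/-- The linearized Engel identity: in a group of exponent `p` the sum over all orderings of the
iterated commutators of `u 1, …, u (p - 1)` with `x - 1`, where `u i = z i - 1`, has higher order
than its terms. -/
theorem sum_perm_prod_innerEnd_mem (hexp : ∀ g : G, g ^ p = 1) {n : Fin (p - 1) → ℕ}
    (hn : ∀ i, 0 < n i) {z : Fin (p - 1) → G}
    (hz : ∀ i, z i ∈ dimensionSubgroup (ZMod p) G (n i)) {d : ℕ} (hd : 0 < d) {x : G}
    (hx : x ∈ dimensionSubgroup (ZMod p) G d) :
    (∑ σ : Equiv.Perm (Fin (p - 1)), (List.ofFn fun i =>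
      innerEnd p G (MonoidAlgebra.of (ZMod p) G (z (σ i)) - 1)).prod)
        (MonoidAlgebra.of (ZMod p) G x - 1)
      ∈ (augmentationFiltration p G).I (∑ i, n i + d + 1) := by
  obtain ⟨h1, h2, h3⟩ := isMoebius_subsetProd hn hz (List.finRange (p - 1))
  have hs : ∀ S : Finset (Fin (p - 1)), ((List.finRange (p - 1)).map fun i =>
      if i ∈ S then MonoidAlgebra.of (ZMod p) G (z i) - 1 else 0).sum
      = ∑ i ∈ S, (MonoidAlgebra.of (ZMod p) G (z i) - 1) := by
    intro S
    rw [← List.ofFn_eq_map, List.sum_ofFn, Finset.sum_ite_mem, Finset.univ_inter]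
  simp only [hs] at h2 h3
  have h0 : IsMoebius (augmentationFiltration p G) n 0 0 (fun S =>
      MonoidAlgebra.of (ZMod p) G (subsetProd z (List.finRange (p - 1)) S)) := by
    have h1 := (h1.mono (Nat.zero_le 1) le_rfl).add
      (IsMoebius.const (augmentationFiltration p G).one_mem)
    simpa only [sub_add_cancel] using h1
  -- `(conj h - 1) ^ (p - 1) (x - 1)` has order `2 d` in `x - 1`, and differs from the commutator
  -- with `∑ u i` by terms with at least `p` factors in the `p - 1` variables.
  have hsum := (isMoebius_sum_conjEnd hexp hn h0 hx).sum_mem_top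
  have hdiff := (isMoebius_conjEnd_sub_one_pow_sub_ad_pow hexp hn h1 h2 h3
    (of_sub_one_mem_iff.2 hx) (p - 1)).2.sum_mem_top
  simp only [sub_one_pow_pred_eq_geom_sum, LinearMap.sum_apply] at hdiff
  have hsum' := (augmentationFiltration p G).antitone
    (show ∑ i, n i + d + 1 ≤ ∑ i, n i + (d + d) + (0 - Fintype.card (Fin (p - 1))) by omega) hsum
  have hdiff' := (augmentationFiltration p G).antitone
    (show ∑ i, n i + d + 1 ≤ ∑ i, n i + d + (p - 1 + 1 - Fintype.card (Fin (p - 1))) by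
      rw [Fintype.card_fin]; omega) hdiff
  rw [sum_perm_prod_eq_sum_neg_one_pow
    (fun i => innerEnd p G (MonoidAlgebra.of (ZMod p) G (z i) - 1))]
  convert sub_mem hsum' hdiff' using 1
  rw [LinearMap.sum_apply, ← Finset.sum_sub_distrib]
  refine Finset.sum_congr rfl fun S _ => ?_
  rw [← mul_sub, sub_sub_cancel, map_sum]
  have hsign : ∀ (k : ℕ) (f : Module.End (ZMod p) (MonoidAlgebra (ZMod p) G))
      (b : MonoidAlgebra (ZMod p) G), ((-1) ^ k * f) b = (-1) ^ k * f b := by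
    intro k f b
    induction k with
    | zero => rw [pow_zero, pow_zero, one_mul, one_mul]
    | succ k ih =>
      rw [pow_succ', mul_assoc, Module.End.mul_apply, LinearMap.neg_apply, Module.End.one_apply, ih,
        pow_succ', neg_one_mul, neg_mul]
  exact hsign _ _ _

end GroupAlgebra

/-! ### The linearized Engel identity for groups of exponent `p` -/

section IteratedCommutators

variable {p : ℕ} [hp : Fact p.Prime] {G : Type*} [Group G] {ι : Type*}

/-- The iterated commutator `[z i₁, [z i₂, …, [z i_r, x]]]` for a list `i₁, …, i_r` of indices. -/
def iterComm (z : ι → G) (x : G) (l : List ι) : G := l.foldr (fun i c => ⁅z i, c⁆) x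

/-- The degree of an iterated commutator. -/
def iterDeg (n : ι → ℕ+) (d : ℕ+) (l : List ι) : ℕ+ := l.foldr (fun i m => n i + m) d

theorem iterDeg_coe (n : ι → ℕ+) (d : ℕ+) (l : List ι) :
    (iterDeg n d l : ℕ) = (l.map fun i => (n i : ℕ)).sum + d := by
  induction l with
  | nil => simp [iterDeg]
  | cons i l ih =>
    rw [iterDeg, List.foldr_cons, ← iterDeg, PNat.add_coe, ih, List.map_cons, List.sum_cons,
      add_assoc]

theorem iterComm_mem (F : CentralSeries G) {n : ι → ℕ+} {d : ℕ+} {z : ι → G} {x : G}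
    (hz : ∀ i, z i ∈ F.N (n i)) (hx : x ∈ F.N d) (l : List ι) :
    iterComm z x l ∈ F.N (iterDeg n d l) := by
  induction l with
  | nil => exact hx
  | cons i l ih => exact F.comm_mem (hz i) ih

theorem of_commutator_sub_one (a b : G) : MonoidAlgebra.of (ZMod p) G ⁅a, b⁆ - 1
    = innerEnd p G (MonoidAlgebra.of (ZMod p) G a - 1) (MonoidAlgebra.of (ZMod p) G b - 1)
      * MonoidAlgebra.of (ZMod p) G (a⁻¹ * b⁻¹) := by
  have e : innerEnd p G (MonoidAlgebra.of (ZMod p) G a - 1) (MonoidAlgebra.of (ZMod p) G b - 1)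
      = MonoidAlgebra.of (ZMod p) G (a * b) - MonoidAlgebra.of (ZMod p) G (b * a) := by
    rw [innerEnd_apply, map_mul, map_mul]; noncomm_ring
  rw [e, sub_mul, ← map_mul, ← map_mul, ← map_one (MonoidAlgebra.of (ZMod p) G)]
  congr 2
  · simp [commutatorElement_def, mul_assoc]
  · group

theorem innerEnd_mem {i j : ℕ} {a b : MonoidAlgebra (ZMod p) G}
    (ha : a ∈ (augmentationFiltration p G).I i) (hb : b ∈ (augmentationFiltration p G).I j) :
    innerEnd p G a b ∈ (augmentationFiltration p G).I (i + j) := by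
  refine sub_mem ((augmentationFiltration p G).mul_mem ha hb) ?_
  rw [add_comm]
  exact (augmentationFiltration p G).mul_mem hb ha

/-- The leading term of an iterated group commutator is the iterated commutator in the group
algebra. -/
theorem of_iterComm_sub_one {n : ι → ℕ+} {d : ℕ+} {z : ι → G} {x : G}
    (hz : ∀ i, z i ∈ (dimensionSeries (ZMod p) G).N (n i))
    (hx : x ∈ (dimensionSeries (ZMod p) G).N d) (l : List ι) :
    MonoidAlgebra.of (ZMod p) G (iterComm z x l) - 1
      - (l.map fun i => innerEnd p G (MonoidAlgebra.of (ZMod p) G (z i) - 1)).prod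
        (MonoidAlgebra.of (ZMod p) G x - 1)
      ∈ (augmentationFiltration p G).I (iterDeg n d l + 1) := by
  induction l with
  | nil =>
    have h : MonoidAlgebra.of (ZMod p) G (iterComm z x []) - 1
        - (([] : List ι).map fun i => innerEnd p G (MonoidAlgebra.of (ZMod p) G (z i) - 1)).prod
        (MonoidAlgebra.of (ZMod p) G x - 1) = 0 := sub_self _
    rw [h]
    exact zero_mem _
  | cons i l ih =>
    have hc : MonoidAlgebra.of (ZMod p) G (iterComm z x l) - 1
        ∈ (augmentationFiltration p G).I (iterDeg n d l) :=
      of_sub_one_mem_iff.2 (iterComm_mem _ hz hx l)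
    have hzi : MonoidAlgebra.of (ZMod p) G (z i) - 1 ∈ (augmentationFiltration p G).I (n i) :=
      of_sub_one_mem_iff.2 (hz i)
    -- `[a, b] - 1` is the ring commutator times a group element, which is `1` up to order one.
    have h1 : MonoidAlgebra.of (ZMod p) G ((z i)⁻¹ * (iterComm z x l)⁻¹) - 1
        ∈ (augmentationFiltration p G).I 1 :=
      of_sub_one_mem_iff.2 ((dimensionSeries (ZMod p) G).mem_one _)
    have h2 := (augmentationFiltration p G).mul_mem (innerEnd_mem hzi hc) h1
    have h3 := innerEnd_mem hzi ih
    have hdeg : (iterDeg n d (i :: l) : ℕ) = n i + iterDeg n d l := PNat.add_coe _ _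
    rw [hdeg]
    have h4 := add_mem h2 h3
    rw [add_assoc]
    rw [add_assoc] at h4
    convert h4 using 1
    have e : iterComm z x (i :: l) = ⁅z i, iterComm z x l⁆ := rfl
    rw [e, of_commutator_sub_one, List.map_cons, List.prod_cons, Module.End.mul_apply,
      LinearMap.map_sub _ (MonoidAlgebra.of (ZMod p) G (iterComm z x l) - 1), mul_sub, mul_one,
      sub_add_sub_cancel]

/-- `g ↦ g - 1` is additive on the `N`-th dimension subgroup, up to terms of order `N + 1`. -/
theorem of_list_prod_sub_one {α : Type*} {N : ℕ} (hN : 0 < N) {g : α → G}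
    (hg : ∀ a, g a ∈ dimensionSubgroup (ZMod p) G N) (l : List α) :
    MonoidAlgebra.of (ZMod p) G (l.map g).prod - 1
      - (l.map fun a => MonoidAlgebra.of (ZMod p) G (g a) - 1).sum
      ∈ (augmentationFiltration p G).I (N + 1) := by
  induction l with
  | nil =>
    simp only [List.map_nil, List.prod_nil, map_one, sub_self, List.sum_nil]
    exact zero_mem _
  | cons a l ih =>
    have h1 : (l.map g).prod ∈ dimensionSubgroup (ZMod p) G N :=
      list_prod_mem fun b hb => by
        obtain ⟨a, -, rfl⟩ := List.mem_map.1 hb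
        exact hg a
    have h2 := (augmentationFiltration p G).mul_mem (of_sub_one_mem_iff.2 (hg a))
      (of_sub_one_mem_iff.2 h1)
    have h3 := add_mem ((augmentationFiltration p G).antitone
      (show N + 1 ≤ N + N by omega) h2) ih
    convert h3 using 1
    rw [List.map_cons, List.prod_cons, map_mul, List.map_cons, List.sum_cons]
    noncomm_ring

theorem iterDeg_ofFn_perm {m : ℕ} (n : Fin m → ℕ+) (d : ℕ+) (σ : Equiv.Perm (Fin m)) :
    iterDeg n d (List.ofFn σ) = iterDeg n d (List.ofFn id) := by
  rw [← PNat.coe_inj, iterDeg_coe, iterDeg_coe, List.map_ofFn, List.map_ofFn, List.sum_ofFn,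
    List.sum_ofFn]
  congr 1
  exact Equiv.sum_comp σ fun i => (n i : ℕ)

/-- The product over all orderings of the iterated commutators of `z 1, …, z (p - 1)` with `x`. -/
def engelProd (p : ℕ) (z : Fin (p - 1) → G) (x : G) : G :=
  ((Finset.univ : Finset (Equiv.Perm (Fin (p - 1)))).toList.map
    fun σ : Equiv.Perm (Fin (p - 1)) => iterComm z x (List.ofFn σ)).prod

theorem engelProd_mem_dimensionSeries (hexp : ∀ g : G, g ^ p = 1) {n : Fin (p - 1) → ℕ+} {d : ℕ+}
    {z : Fin (p - 1) → G} {x : G} (hz : ∀ i, z i ∈ (dimensionSeries (ZMod p) G).N (n i))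
    (hx : x ∈ (dimensionSeries (ZMod p) G).N d) :
    engelProd p z x ∈ (dimensionSeries (ZMod p) G).N (iterDeg n d (List.ofFn id) + 1) := by
  set N := iterDeg n d (List.ofFn id) with hN
  have hNe : (N : ℕ) = ∑ i, (n i : ℕ) + d := by
    rw [hN, iterDeg_coe, List.map_ofFn, List.sum_ofFn]; rfl
  refine of_sub_one_mem_iff.1 ?_
  have hmem : ∀ σ : Equiv.Perm (Fin (p - 1)),
      iterComm z x (List.ofFn σ) ∈ dimensionSubgroup (ZMod p) G N := fun σ => by
    rw [hN, ← iterDeg_ofFn_perm n d σ]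
    exact iterComm_mem _ hz hx _
  have h1 := of_list_prod_sub_one N.pos hmem Finset.univ.toList
  rw [Finset.sum_map_toList] at h1
  have h2 : ∀ σ : Equiv.Perm (Fin (p - 1)), _ := fun σ => of_iterComm_sub_one hz hx (List.ofFn σ)
  simp only [iterDeg_ofFn_perm, List.map_ofFn] at h2
  have h3 := sum_mem fun σ (_ : σ ∈ Finset.univ) => h2 σ
  have h4 := sum_perm_prod_innerEnd_mem hexp (fun i => (n i).pos) hz d.pos hx
  rw [← hNe] at h4
  have h5 := add_mem (add_mem h1 h3) h4
  rw [PNat.add_coe, PNat.one_coe]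
  convert h5 using 1
  simp only [Finset.sum_sub_distrib, LinearMap.sum_apply, Function.comp_def, engelProd]
  abel

/-- The passage to the closures uses only that `engelProd` is continuous in all arguments. -/
theorem engelProd_mem_zassenhausSeries [TopologicalSpace G] [IsTopologicalGroup G]
    (hexp : ∀ g : G, g ^ p = 1) {n : Fin (p - 1) → ℕ+} {d : ℕ+}
    {z : Fin (p - 1) → G} {x : G} (hz : ∀ i, z i ∈ (zassenhausSeries p G).N (n i))
    (hx : x ∈ (zassenhausSeries p G).N d) :
    engelProd p z x ∈ (zassenhausSeries p G).N (iterDeg n d (List.ofFn id) + 1) := by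
  have hiter : ∀ l : List (Fin (p - 1)),
      Continuous fun q : (Fin (p - 1) → G) × G => iterComm q.1 q.2 l := by
    intro l
    induction l with
    | nil => exact continuous_snd
    | cons i l ih =>
      change Continuous fun q : (Fin (p - 1) → G) × G => ⁅q.1 i, iterComm q.1 q.2 l⁆
      simp only [commutatorElement_def]
      fun_prop
  have hc : Continuous fun q : (Fin (p - 1) → G) × G => engelProd p q.1 q.2 := by
    unfold engelProd
    exact continuous_list_prod _ fun σ _ => hiter _
  have hcl : ((z, x) : (Fin (p - 1) → G) × G) ∈ closure
      ((Set.univ.pi fun i => ((dimensionSeries (ZMod p) G).N (n i) : Set G))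
        ×ˢ ((dimensionSeries (ZMod p) G).N d : Set G)) := by
    rw [closure_prod_eq, closure_pi_set]
    exact ⟨fun i _ => hz i, hx⟩
  refine map_mem_closure (f := fun q : (Fin (p - 1) → G) × G => engelProd p q.1 q.2) hc hcl ?_
  rintro ⟨z, x⟩ ⟨hz, hx⟩
  exact engelProd_mem_dimensionSeries hexp (fun i => hz i (Set.mem_univ i)) hx

end IteratedCommutators

/-! ### The Engel condition in the Zassenhaus Lie algebra -/

section Engel

open CentralSeries

variable {p : ℕ} [hp : Fact p.Prime] {G : Type*} [Group G]

theorem cls_list_prod {F : CentralSeries G} {N : ℕ+} {α : Type*} {g : α → G}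
    (hg : ∀ a, g a ∈ F.N N) (l : List α) (hl : (l.map g).prod ∈ F.N N) :
    F.cls N (l.map g).prod hl = (l.map fun a => F.cls N (g a) (hg a)).sum := by
  induction l with
  | nil => exact cls_one N
  | cons a l ih =>
    have h : (l.map g).prod ∈ F.N N := by
      refine (mul_mem_cancel_left (hg a)).1 ?_
      rwa [List.map_cons, List.prod_cons] at hl
    refine (cls_congr rfl List.prod_cons _ (mul_mem (hg a) h)).trans ?_
    rw [cls_mul (hg a) h, ih h]
    rfl

variable [TopologicalSpace G] [IsTopologicalGroup G]

theorem prod_ad_cls {ι : Type*} {n : ι → ℕ+} {d : ℕ+}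
    {z : ι → G} {x : G} (hz : ∀ i, z i ∈ (zassenhausSeries p G).N (n i))
    (hx : x ∈ (zassenhausSeries p G).N d) (l : List ι) :
    (l.map fun i => LieAlgebra.ad (ZMod p) (ZassenhausLie p G)
      ((zassenhausSeries p G).cls (n i) (z i) (hz i))).prod ((zassenhausSeries p G).cls d x hx)
      = (zassenhausSeries p G).cls (iterDeg n d l) (iterComm z x l) (iterComm_mem _ hz hx l) := by
  induction l with
  | nil => rfl
  | cons i l ih =>
    rw [List.map_cons, List.prod_cons, Module.End.mul_apply, ih, LieAlgebra.ad_apply, lie_cls]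
    rfl

/-- A multilinear map on the associated graded which vanishes on homogeneous elements is zero. -/
theorem multilinear_eq_zero_of_cls {m : ℕ} {A : Type*} [AddCommGroup A] [Module (ZMod p) A]
    (f : MultilinearMap (ZMod p) (fun _ : Fin m => ZassenhausLie p G) A)
    (h : ∀ (n : Fin m → ℕ+) (z : Fin m → G) (hz : ∀ i, z i ∈ (zassenhausSeries p G).N (n i)),
      f (fun i => (zassenhausSeries p G).cls (n i) (z i) (hz i)) = 0) : f = 0 := by
  have key : ∀ (s : Finset (Fin m)) (v : Fin m → ZassenhausLie p G),
      (∀ i ∉ s, ∃ n z, ∃ hz : z ∈ (zassenhausSeries p G).N n,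
        v i = (zassenhausSeries p G).cls n z hz) → f v = 0 := by
    intro s
    induction s using Finset.induction_on with
    | empty =>
      intro v hv
      choose n z hz hv using fun i => hv i (Finset.notMem_empty i)
      rw [funext hv]
      exact h n z hz
    | insert a s ha ih =>
      intro v hv
      rw [← Function.update_eq_self a v]
      induction v a using CentralSeries.induction with
      | h0 => exact f.map_coord_zero a (Function.update_self ..)
      | hadd x y hx hy => rw [f.map_update_add, hx, hy, add_zero]
      | hcls n x hx =>
        refine ih _ fun i hi => ?_
        by_cases hia : i = a
        · subst hia
          exact ⟨n, x, hx, Function.update_self ..⟩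
        · rw [Function.update_of_ne hia]
          exact hv i (by simp [hia, hi])
  ext v
  exact key Finset.univ v fun i hi => absurd (Finset.mem_univ i) hi

/-- In exponent `p` the Zassenhaus Lie algebra satisfies the `(p - 1)`-st Engel condition. -/
theorem ad_pow_pred_eq_zero (hexp : ∀ g : G, g ^ p = 1) (z : ZassenhausLie p G) :
    LieAlgebra.ad (ZMod p) (ZassenhausLie p G) z ^ (p - 1) = 0 := by
  let adL : ZassenhausLie p G →ₗ[ZMod p] Module.End (ZMod p) (ZassenhausLie p G) :=
    { toFun := fun x => LieAlgebra.ad (ZMod p) (ZassenhausLie p G) x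
      map_add' := fun x y => by ext; simp
      map_smul' := fun c x => by ext; simp }
  let g : MultilinearMap (ZMod p) (fun _ : Fin (p - 1) => ZassenhausLie p G)
      (Module.End (ZMod p) (ZassenhausLie p G)) :=
    (MultilinearMap.mkPiAlgebraFin (ZMod p) (p - 1) _).compLinearMap
      fun _ => adL
  let f : MultilinearMap (ZMod p) (fun _ : Fin (p - 1) => ZassenhausLie p G)
      (Module.End (ZMod p) (ZassenhausLie p G)) :=
    ∑ σ : Equiv.Perm (Fin (p - 1)), g.domDomCongr σ
  have hf : ∀ v, f v = ∑ σ : Equiv.Perm (Fin (p - 1)),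
      (List.ofFn fun i => LieAlgebra.ad (ZMod p) (ZassenhausLie p G) (v (σ i))).prod := by
    intro v
    simp only [f, sum_apply]
    rfl
  have hf0 : f = 0 := by
    refine multilinear_eq_zero_of_cls f fun n z hz => ?_
    ext x
    rw [hf, LinearMap.sum_apply, LinearMap.zero_apply]
    induction x using CentralSeries.induction with
    | h0 => simp
    | hadd x y hx hy => simp only [map_add, Finset.sum_add_distrib, hx, hy, add_zero]
    | hcls d x hx =>
      have hmem : ∀ σ : Equiv.Perm (Fin (p - 1)), iterComm z x (List.ofFn σ)
          ∈ (zassenhausSeries p G).N (iterDeg n d (List.ofFn id)) := fun σ => by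
        rw [← iterDeg_ofFn_perm n d σ]
        exact iterComm_mem _ hz hx _
      have h1 : ∀ σ : Equiv.Perm (Fin (p - 1)),
          (List.ofFn fun i => LieAlgebra.ad (ZMod p) (ZassenhausLie p G)
            ((zassenhausSeries p G).cls (n (σ i)) (z (σ i)) (hz (σ i)))).prod
            ((zassenhausSeries p G).cls d x hx)
          = (zassenhausSeries p G).cls (iterDeg n d (List.ofFn id)) _ (hmem σ) := by
        intro σ
        have h2 := prod_ad_cls hz hx (List.ofFn σ)
        rw [List.map_ofFn] at h2
        exact h2.trans (cls_congr (iterDeg_ofFn_perm n d σ) rfl _ _)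
      have h3 := engelProd_mem_zassenhausSeries hexp hz hx
      rw [engelProd] at h3
      rw [Finset.sum_congr rfl fun σ _ => h1 σ, ← Finset.sum_map_toList,
        ← cls_list_prod hmem _ ((zassenhausSeries p G).antitone (PNat.lt_add_right _ 1).le h3)]
      exact cls_eq_zero _ h3
  have h := hf fun _ => z
  -- At equal arguments the symmetrized product is `(p - 1)!` times the power, and `p ∤ (p - 1)!`.
  rw [hf0, zero_apply] at h
  simp only [List.ofFn_const, List.prod_replicate, Finset.sum_const, Finset.card_univ,
    Fintype.card_perm, Fintype.card_fin] at h
  rw [← Nat.cast_smul_eq_nsmul (ZMod p), eq_comm, smul_eq_zero] at h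
  refine h.resolve_left ?_
  rw [ZMod.natCast_eq_zero_iff, hp.out.dvd_factorial]
  have := hp.out.pos
  omega

end Engel

/-! ### The `p`-map of the Zassenhaus Lie algebra -/

section PMapZero

open CentralSeries

/-- A polynomial of degree less than `p` with coefficients in a vector space over `𝔽_p` which
vanishes at all points of `𝔽_p` is zero. -/
theorem eq_zero_of_forall_sum_pow_smul_eq_zero (p : ℕ) [hp : Fact p.Prime] {V : Type*}
    [AddCommGroup V] [Module (ZMod p) V] {c : ℕ → V}
    (h : ∀ a : ZMod p, ∑ j ∈ Finset.range p, a ^ j • c j = 0) {j : ℕ} (hj : j < p) : c j = 0 := by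
  rw [← Module.forall_dual_apply_eq_zero_iff (ZMod p)]
  intro φ
  have h1 : (∑ j ∈ Finset.range p, Polynomial.monomial j (φ (c j)) : Polynomial (ZMod p)) = 0 := by
    refine Polynomial.eq_zero_of_degree_lt_of_eval_finset_eq_zero Finset.univ ?_ fun a _ => ?_
    · rw [Finset.card_univ, ZMod.card]
      refine (Polynomial.degree_sum_le _ _).trans_lt ?_
      refine (Finset.sup_lt_iff (WithBot.bot_lt_coe p)).2 ?_
      exact fun i hi => (Polynomial.degree_monomial_le _ _).trans_lt
        (Nat.cast_lt.2 (Finset.mem_range.1 hi))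
    · have h2 := congrArg φ (h a)
      simpa [Polynomial.eval_finsetSum, mul_comm] using h2
  have h2 := congrArg (fun q => Polynomial.coeff q j) h1
  simpa [Polynomial.finsetSum_coeff, Polynomial.coeff_monomial, hj] using h2

/-- In a Lie algebra over `𝔽_p` with the `(p - 1)`-st Engel condition the correction terms
`s_k(x, y)` vanish: they are the coefficients of a polynomial in `t` of degree less than `p`, all of
whose values `ad (t x + y) ^ (p - 1) (x)` with `t ∈ 𝔽_p` are zero. -/
theorem sTerm_eq_zero_of_engel {p : ℕ} [hp : Fact p.Prime] {L : Type*} [LieRing L]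
    [LieAlgebra (ZMod p) L] (hL : ∀ z : L, LieAlgebra.ad (ZMod p) L z ^ (p - 1) = 0) {k : ℕ}
    (hk : k ≤ p) (x y : L) : sTerm (ZMod p) p k x y = 0 := by
  have hp1 := hp.out.pos
  refine eq_zero_of_forall_sum_pow_smul_eq_zero p (c := fun j =>
    ((Polynomial.C (LieAlgebra.ad (ZMod p) L x) * Polynomial.X
      + Polynomial.C (LieAlgebra.ad (ZMod p) L y)) ^ (p - 1)).coeff j x) (fun a => ?_)
    (j := k - 1) (by omega)
  simp only [coeff_eq_sRec]
  have key : ∀ m, ∑ j ∈ Finset.range (m + 1), a ^ j • sRec x y m j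
      = (LieAlgebra.ad (ZMod p) L (a • x + y) ^ m) x := by
    have htop : ∀ m j, m < j → sRec x y m j = 0 := by
      intro m
      induction m with
      | zero => intro j hj; obtain ⟨j, rfl⟩ := Nat.exists_eq_succ_of_ne_zero hj.ne'; rfl
      | succ m ih =>
        intro j hj
        obtain ⟨j, rfl⟩ := Nat.exists_eq_succ_of_ne_zero (Nat.ne_zero_of_lt hj)
        rw [sRec, ih j (by omega), ih (j + 1) (by omega), lie_zero, lie_zero, add_zero]
    intro m
    induction m with
    | zero => simp [sRec]
    | succ m ih =>
      have h1 : ∑ j ∈ Finset.range (m + 1), a ^ (j + 1) • sRec x y m (j + 1)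
          + a ^ 0 • sRec x y m 0 = ∑ j ∈ Finset.range (m + 1), a ^ j • sRec x y m j := by
        rw [← Finset.sum_range_succ' (fun j => a ^ j • sRec x y m j) (m + 1),
          Finset.sum_range_succ, htop m (m + 1) (Nat.lt_succ_self m), smul_zero, add_zero]
      rw [pow_succ', Module.End.mul_apply, ← ih, LieAlgebra.ad_apply, add_lie, ← h1,
        Finset.sum_range_succ', h1]
      simp only [sRec, smul_add, Finset.sum_add_distrib, ← lie_smul, ← lie_sum]
      rw [add_assoc, ← lie_add, h1, smul_lie, ← lie_smul, Finset.smul_sum]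
      simp only [pow_succ', mul_smul]
  have h := key (p - 1)
  rw [hL, Nat.sub_add_cancel hp.out.one_le] at h
  exact h

theorem PMap.ext_toFun {p : ℕ} {F L : Type*} [Field F] [LieRing L]
    [LieAlgebra F L] {q q' : PMap p F L}
    (h : ∀ x, q x = q' x) : q = q' := by
  cases q; cases q'
  congr
  exact funext h

/-- With the `(p - 1)`-st Engel condition the zero map is a `p`-map. -/
def PMap.zeroOfEngel {p : ℕ} [hp : Fact p.Prime] {L : Type*} [LieRing L]
    [LieAlgebra (ZMod p) L] (hL : ∀ z : L, LieAlgebra.ad (ZMod p) L z ^ (p - 1) = 0) :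
    PMap p (ZMod p) L where
  toFun _ := 0
  map_smul' _ _ := (smul_zero _).symm
  map_add' x y := by
    rw [Finset.sum_eq_zero fun k hk => ?_, add_zero, add_zero]
    have := Finset.mem_Icc.1 hk
    rw [sTerm_eq_zero_of_engel hL (by omega), smul_zero]
  lie_toFun' x y := by
    have h : LieAlgebra.ad (ZMod p) L x ^ p
        = LieAlgebra.ad (ZMod p) L x ^ (p - 1) * LieAlgebra.ad (ZMod p) L x := by
      rw [← pow_succ, Nat.sub_add_cancel hp.out.one_le]
    rw [zero_lie, h, hL, zero_mul, LinearMap.zero_apply]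

variable {p : ℕ} [hp : Fact p.Prime] {G : Type*} [Group G] [TopologicalSpace G]
  [IsTopologicalGroup G]

theorem isInducedByPower_zeroOfEngel (hexp : ∀ g : G, g ^ p = 1) :
    IsInducedByPower (PMap.zeroOfEngel (ad_pow_pred_eq_zero (p := p) (G := G) hexp)) := by
  intro n x hx
  exact (cls_one _).symm.trans (cls_congr rfl (hexp x).symm _ _)

theorem IsInducedByPower.eq_zero (hexp : ∀ g : G, g ^ p = 1)
    {q : PMap p (ZMod p) (ZassenhausLie p G)} (hq : IsInducedByPower q) (x : ZassenhausLie p G) :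
    q x = 0 := by
  induction x using CentralSeries.induction with
  | h0 =>
    have h := q.map_smul' 0 0
    rwa [smul_zero, zero_pow hp.out.ne_zero, zero_smul] at h
  | hcls n x hx =>
    rw [hq]
    exact (cls_congr rfl (hexp x) _ _).trans (cls_one _)
  | hadd x y hx hy =>
    have h := q.map_add' x y
    rw [Finset.sum_eq_zero fun k hk => ?_, add_zero] at h
    · rw [h, hx, hy, add_zero]
    · have := Finset.mem_Icc.1 hk
      rw [sTerm_eq_zero_of_engel (ad_pow_pred_eq_zero hexp) (by omega), smul_zero]

theorem cls_mem_zassenhausComponent {n : ℕ+} {x : G} (hx : x ∈ (zassenhausSeries p G).N n) :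
    (zassenhausSeries p G).cls n x hx ∈ zassenhausComponent p G n :=
  ⟨_, rfl⟩

theorem exists_cls_of_mem_zassenhausComponent {n : ℕ+} {y : ZassenhausLie p G}
    (hy : y ∈ zassenhausComponent p G n) :
    ∃ x, ∃ hx : x ∈ (zassenhausSeries p G).N n, y = (zassenhausSeries p G).cls n x hx := by
  obtain ⟨a, rfl⟩ := hy
  obtain ⟨⟨g, hg⟩, h⟩ := QuotientGroup.mk_surjective (Additive.toMul a)
  refine ⟨g, hg, ?_⟩
  rw [cls, h]
  rfl

theorem isInternal_zassenhausComponent :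
    DirectSum.IsInternal (zassenhausComponent p G) := by
  let e : ∀ n, Additive ((zassenhausSeries p G).Comp n) ≃+ zassenhausComponent p G n := fun n =>
    AddMonoidHom.ofInjective (f := (zassenhausSeries p G).of n) (DirectSum.of_injective n)
  let E : ZassenhausLie p G ≃+ ⨁ n, zassenhausComponent p G n := DFinsupp.mapRange.addEquiv e
  have h : (DirectSum.coeAddMonoidHom (zassenhausComponent p G)).comp E.toAddMonoidHom
      = AddMonoidHom.id (ZassenhausLie p G) := by
    refine DirectSum.addHom_ext fun n a => ?_
    have h1 : E ((zassenhausSeries p G).of n a)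
        = DirectSum.of (fun n => zassenhausComponent p G n) n (e n a) :=
      DFinsupp.mapRange_single (hf := fun i => map_zero (e i))
    change DirectSum.coeAddMonoidHom (zassenhausComponent p G) (E ((zassenhausSeries p G).of n a))
      = (zassenhausSeries p G).of n a
    rw [h1, DirectSum.coeAddMonoidHom_of]
    rfl
  have h2 : ⇑(DirectSum.coeAddMonoidHom (zassenhausComponent p G)) = E.symm := by
    ext y
    obtain ⟨x, rfl⟩ := E.surjective y
    rw [E.symm_apply_apply]
    exact DFunLike.congr_fun h x
  rw [DirectSum.IsInternal, h2]
  exact E.symm.bijective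

theorem isGrading_zassenhausComponent (hexp : ∀ g : G, g ^ p = 1)
    {q : PMap p (ZMod p) (ZassenhausLie p G)} (hq : IsInducedByPower q) :
    q.IsGrading (zassenhausComponent p G) where
  isInternal := isInternal_zassenhausComponent
  lie_mem := by
    intro i j x y hx hy
    obtain ⟨g, hg, rfl⟩ := exists_cls_of_mem_zassenhausComponent hx
    obtain ⟨h, hh, rfl⟩ := exists_cls_of_mem_zassenhausComponent hy
    rw [lie_cls]
    exact cls_mem_zassenhausComponent _
  pow_mem := fun _ _ => by rw [hq.eq_zero hexp]; exact zero_mem _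

end PMapZero

/-! ### The Magnus–Zassenhaus kernel -/

section Kernel

open CentralSeries

/-- The terms of `ad (t x + y) ^ (m + 1) (x)` without a factor `y` vanish since `[x, x] = 0`. -/
theorem sRec_mem {F L : Type*} [Field F] [LieRing L] [LieAlgebra F L] (I : LieIdeal F L) {x y : L}
    (hy : y ∈ I) (m j : ℕ) : sRec x y (m + 1) j ∈ I := by
  induction m generalizing j with
  | zero =>
    rcases j with _ | _ | j
    · exact lie_mem_left F L I y x hy
    · simp [sRec]
    · simp [sRec]
  | succ m ih =>
    cases j with
    | zero => exact I.lie_mem (ih 0)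
    | succ j => exact add_mem (I.lie_mem (ih j)) (I.lie_mem (ih (j + 1)))

/-- A `p`-map respects congruence modulo a restricted ideal. -/
theorem PMap.add_sub_mem {p : ℕ} [hp : Fact p.Prime] {F L : Type*} [Field F] [LieRing L]
    [LieAlgebra F L] (q : PMap p F L) {I : LieIdeal F L} (hI : q.IsRestrictedIdeal I) (x : L)
    {y : L} (hy : y ∈ I) : q (x + y) - q x ∈ I := by
  have h := q.map_add' x y
  rw [h, add_assoc, add_sub_cancel_left]
  refine add_mem (hI y hy) (sum_mem fun k _ => I.smul_mem _ ?_)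
  obtain ⟨r, hr⟩ := Nat.exists_eq_add_of_le' hp.out.two_le
  rw [sTerm, coeff_eq_sRec, show p - 1 = r + 1 by omega]
  exact sRec_mem I hy r _

/-- Modulo the restricted ideal generated by the `p`-th powers of elements of `L`, every element of
the restrictification `L^{[p]}` comes from `L`. -/
theorem Restrictification.exists_sub_of_mem_span {p : ℕ} [hp : Fact p.Prime] {F L : Type*} [Field F]
    [LieRing L] [LieAlgebra F L] (a : Restrictification p F L) :
    ∃ x : L, a - of p F L x ∈
      (pMap p F L).restrictedIdealSpan (Set.range fun x : L => pMap p F L (of p F L x)) := by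
  set I := (pMap p F L).restrictedIdealSpan (Set.range fun x : L => pMap p F L (of p F L x))
  obtain ⟨a, rfl⟩ := toQuot_surjective a
  induction a with
  | of x => exact ⟨x, by rw [show of p F L x = toQuot (.of x) from rfl, sub_self]; exact zero_mem I⟩
  | zero => exact ⟨0, by rw [map_zero, sub_zero]; exact zero_mem I⟩
  | add a b ha hb =>
    obtain ⟨x, hx⟩ := ha
    obtain ⟨y, hy⟩ := hb
    refine ⟨x + y, ?_⟩
    change toQuot a + toQuot b - _ ∈ I
    rw [map_add, add_sub_add_comm]
    exact add_mem hx hy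
  | smul r a ha =>
    obtain ⟨x, hx⟩ := ha
    refine ⟨r • x, ?_⟩
    change r • toQuot a - _ ∈ I
    rw [map_smul, ← smul_sub]
    exact I.smul_mem r hx
  | lie a b ha hb =>
    obtain ⟨x, hx⟩ := ha
    obtain ⟨y, hy⟩ := hb
    refine ⟨⁅x, y⁆, ?_⟩
    change ⁅(toQuot a : Restrictification p F L), (toQuot b : Restrictification p F L)⁆ - _ ∈ I
    have e : ⁅(toQuot a : Restrictification p F L), (toQuot b : Restrictification p F L)⁆
        - of p F L ⁅x, y⁆ = ⁅toQuot a - of p F L x, toQuot b⁆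
          + ⁅of p F L x, toQuot b - of p F L y⁆ := by
      rw [LieHom.map_lie, sub_lie, lie_sub, sub_add_sub_cancel]
    rw [e]
    exact add_mem (lie_mem_left _ _ I _ _ hx) (I.lie_mem hy)
  | pow a ha =>
    obtain ⟨x, hx⟩ := ha
    refine ⟨0, ?_⟩
    rw [map_zero, sub_zero]
    change pMap p F L (toQuot a) ∈ I
    have h1 := PMap.add_sub_mem _ ((pMap p F L).isRestrictedIdeal_span _) (of p F L x) hx
    rw [add_sub_cancel] at h1
    have h2 : pMap p F L (of p F L x) ∈ I := (pMap p F L).subset_span _ ⟨x, rfl⟩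
    have h3 := add_mem h1 h2
    rwa [sub_add_cancel] at h3

variable {p : ℕ} [hp : Fact p.Prime] {G : Type*} [Group G] [TopologicalSpace G]
  [IsTopologicalGroup G]

/-- The inverse of `gr^M(G) → gr^Z(G)` comes from the equality of the two series. -/
theorem theta_injective (hG : IsProP p G) (hexp : ∀ g : G, g ^ p = 1) :
    Function.Injective (theta p G) := by
  let ψ : ZassenhausLie p G →+ MagnusLie G := mapAdd (zassenhausSeries_le p hG hexp)
  have hψ : ∀ x : MagnusLie G, ψ (rho p G x) = x := by
    intro x
    induction x using CentralSeries.induction with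
    | h0 => rw [map_zero, map_zero]
    | hadd x y hx hy => rw [map_add, map_add, hx, hy]
    | hcls n x hx =>
      have h : rho p G ((magnusSeries G).cls n x hx)
          = (zassenhausSeries p G).cls n x (magnusSeries_le p G n hx) := map_cls _ hx
      rw [h]
      exact mapAdd_cls _ _
  have hleft : ∀ a : MagnusLieModP p G, (1 : ZMod p) ⊗ₜ[ℤ] ψ (theta p G a) = a := by
    intro a
    induction a using TensorProduct.induction_on with
    | zero => rw [map_zero, map_zero, TensorProduct.tmul_zero]
    | add a b ha hb => rw [map_add, map_add, TensorProduct.tmul_add, ha, hb]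
    | tmul r x =>
      obtain ⟨n, rfl⟩ := ZMod.natCast_zmod_surjective r
      rw [theta_tmul, Nat.cast_smul_eq_nsmul, map_nsmul, hψ]
      induction n with
      | zero => rw [zero_smul, Nat.cast_zero, TensorProduct.tmul_zero, TensorProduct.zero_tmul]
      | succ n ih =>
        rw [succ_nsmul, TensorProduct.tmul_add, ih, Nat.cast_succ, TensorProduct.add_tmul]
  intro a b hab
  rw [← hleft a, ← hleft b, hab]

theorem ker_thetaHat (hG : IsProP p G) (hexp : ∀ g : G, g ^ p = 1)
    {q : PMap p (ZMod p) (ZassenhausLie p G)} (hq : IsInducedByPower q) :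
    (thetaHat q).ker =
      (Restrictification.pMap p (ZMod p) (MagnusLieModP p G)).restrictedIdealSpan
        (Set.range fun x : MagnusLieModP p G =>
          Restrictification.pMap p (ZMod p) (MagnusLieModP p G)
            (Restrictification.of p (ZMod p) (MagnusLieModP p G) x)) := by
  have hpow : ∀ a, thetaHat q (Restrictification.pMap p (ZMod p) (MagnusLieModP p G) a) = 0 :=
    fun a => (Restrictification.lift_pow q (theta p G) a).trans (hq.eq_zero hexp _)
  have hle : (Restrictification.pMap p (ZMod p) (MagnusLieModP p G)).restrictedIdealSpan
        (Set.range fun x : MagnusLieModP p G =>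
          Restrictification.pMap p (ZMod p) (MagnusLieModP p G)
            (Restrictification.of p (ZMod p) (MagnusLieModP p G) x)) ≤ (thetaHat q).ker := by
    refine sInf_le ⟨fun a _ => ?_, ?_⟩
    · rw [LieHom.mem_ker]
      exact hpow a
    · rintro _ ⟨x, rfl⟩
      rw [SetLike.mem_coe, LieHom.mem_ker]
      exact hpow _
  refine le_antisymm (fun a ha => ?_) hle
  obtain ⟨x, hx⟩ := Restrictification.exists_sub_of_mem_span a
  have h1 := hle hx
  rw [LieHom.mem_ker] at ha h1
  rw [map_sub, ha, zero_sub, neg_eq_zero] at h1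
  have h2 : theta p G x = 0 := h1
  have h3 : x = 0 := theta_injective hG hexp (h2.trans (map_zero _).symm)
  rwa [h3, map_zero, sub_zero] at hx

end Kernel

theorem corollary1 (p : ℕ) [Fact p.Prime] (G : Type*) [Group G] [TopologicalSpace G]
    [IsTopologicalGroup G] (hG : IsProP p G) (hexp : ∀ g : G, g ^ p = 1) :
    (∃! q : PMap p (ZMod p) (ZassenhausLie p G), IsInducedByPower q) ∧
    ∀ q : PMap p (ZMod p) (ZassenhausLie p G), IsInducedByPower q →
      q.IsGrading (zassenhausComponent p G) ∧
      (∀ x : ZassenhausLie p G, q x = 0) ∧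
      (thetaHat q).ker =
        (Restrictification.pMap p (ZMod p) (MagnusLieModP p G)).restrictedIdealSpan
          (Set.range fun x : MagnusLieModP p G =>
            Restrictification.pMap p (ZMod p) (MagnusLieModP p G)
              (Restrictification.of p (ZMod p) (MagnusLieModP p G) x)) := by
  refine ⟨⟨_, isInducedByPower_zeroOfEngel hexp, fun q hq => ?_⟩, fun q hq =>
    ⟨isGrading_zassenhausComponent hexp hq, hq.eq_zero hexp, ker_thetaHat hG hexp hq⟩⟩
  exact PMap.ext_toFun fun x => hq.eq_zero hexp x

end
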